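/- **Conventions.** A *weighted graph* $(E,\omega)$ consists of countable sets $E^0$ (vertices) and $E^{\mathrm{st}}$ (structured edges), maps $s,r:E^{\mathrm{st}}\to E^0$ and a weight map $\omega:E^{\mathrm{st}}\to\{1,2,\dots\}$; it is assumed row-finite, i.e. $s^{-1}(v)$ is finite for every $v\in E^0$. Each $\alpha\in E^{\mathrm{st}}$ gives $\omega(\alpha)$ edges $\alpha_1,\dots,\alpha_{\omega(\alpha)}$. A vertex $v$ is a sink if $s^{-1}(v)=\emptyset$; otherwise $\omega(v)=\max\{\omega(\alpha)\mid s(\alpha)=v\}$. Let $R$ be a unital, not necessarily commutative, ring. The *weighted Leavitt path algebra* $L_R(E,\omega)$ is the (not necessarily unital) $R$-ring generated by the symbols $v$ ($v\in E^0$) and $\alpha_i,\alpha_i^*$ ($\alpha\in E^{\mathrm{st}}$, $1\le i\le\omega(\alpha)$), the elements of $R$ commuting with the generators, subject to the relations 1. $vw=\delta_{vw}v$ for $v,w\in E^0$; 2. $s(\alpha)\alpha_i=\alpha_i=\alpha_i r(\alpha)$ and $r(\alpha)\alpha_i^*=\alpha_i^*=\alpha_i^*s(\alpha)$ for $\alpha\in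 E^{\mathrm{st}}$, $1\le i\le\omega(\alpha)$; 3. $\sum_{s(\alpha)=v}\alpha_i\alpha_j^*=\delta_{ij}v$ for every $v\in E^0$ that is not a sink and $1\le i,j\le\omega(v)$; 4. $\sum_{1\le i\le\max\{\omega(\alpha),\omega(\beta)\}}\alpha_i^*\beta_i=\delta_{\alpha\beta}r(\alpha)$ for $\alpha,\beta\in E^{\mathrm{st}}$; where in (3) and (4) $\alpha_i$ and $\alpha_i^*$ are read as $0$ if $i>\omega(\alpha)$. A *domain* is a nonzero ring without zero divisors. A *rose* is a weighted graph with exactly one vertex; its structured edges are its *petals*. A weighted graph is *unweighted* if $\omega(\alpha)=1$ for all $\alpha\in E^{\mathrm{st}}$. An *LV-rose* is a rose with at least one petal such that $\omega(\alpha)\ge 2$ for all $\alpha\in E^{\mathrm{st}}$ and at least two petals have the maximal weight $\omega(v)$, where $v$ is the vertex. For $n\ge1$ and $k\ge 0$, the *Leavitt algebra* $L_R(n,n+k)$ is the unital $R$-ring generated by the entries of an $n\times(n+k)$ matrix $Y$ and of an $(n+k)\times n$ matrix $X$ of symbols commuting with $R$, subject to $YX=I_n$ and $XY=I_{n+k}$.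 **Theorem.** Let $R$ be a unital ring. (a) For every weighted graph $(E,\omega)$, the ring $L_R(E,\omega)$ is a domain if and only if $R$ is a domain and $(E,\omega)$ is either an unweighted rose with at most one petal or an LV-rose. (b) If $R$ is a domain, then $L_R(n,n+k)$ is a domain for all $n\ge 2$ and $k\ge 0$. -/

import Mathlib

universe u v w

/-- A (countable, row-finite) weighted graph: vertices, structured edges, source and range maps,
and a weight map with positive values. A structured edge `α` of weight `k` stands for `k` edges
`α_1, …, α_k`, which are indexed here by `Fin k`, that is, from `0` to `k - 1`. -/
structure WeightedGraph where
  /-- the vertices -/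
  Vertex : Type u
  /-- the structured edges -/
  StEdge : Type v
  countable_vertex : Countable Vertex
  countable_stEdge : Countable StEdge
  /-- the source of a structured edge -/
  source : StEdge → Vertex
  /-- the range of a structured edge -/
  range : StEdge → Vertex
  /-- the weight of a structured edge -/
  weight : StEdge → ℕ
  weight_pos : ∀ α, 0 < weight α
  rowFinite : ∀ v, {α | source α = v}.Finite

namespace WeightedGraph

variable (E : WeightedGraph.{u, v})

/-- The finite set `s⁻¹(v)` of structured edges emitted by `v`. -/
noncomputable def outEdges (v : E.Vertex) : Finset E.StEdge := (E.rowFinite v).toFinset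

/-- A vertex is a sink if it emits no structured edge. -/
def IsSink (v : E.Vertex) : Prop := ∀ α, E.source α ≠ v

/-- `ω(v)`, the maximal weight of a structured edge emitted by `v` (it is `0` if `v` is a sink). -/
noncomputable def maxWeight (v : E.Vertex) : ℕ := (E.outEdges v).sup E.weight

/-- The alphabet `X = E⁰ ∪ E¹ ∪ (E¹)*`. -/
inductive Gen : Type (max u v)
  | vertex (v : E.Vertex) : Gen
  | edge (α : E.StEdge) (i : Fin (E.weight α)) : Gen
  | ghost (α : E.StEdge) (i : Fin (E.weight α)) : Gen

variable {E} in
/-- The source of a generator; `α_i*` runs backwards. -/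
def Gen.src : E.Gen → E.Vertex
  | .vertex v => v
  | .edge α _ => E.source α
  | .ghost α _ => E.range α

variable {E} in
/-- The range of a generator. -/
def Gen.tgt : E.Gen → E.Vertex
  | .vertex v => v
  | .edge α _ => E.range α
  | .ghost α _ => E.source α

/-- `E.GenPath u v`: there is a generalised path from `u` to `v`, that is, a finite sequence of
composable generators. -/
def GenPath : E.Vertex → E.Vertex → Prop :=
  Relation.ReflTransGen fun u v => ∃ x : E.Gen, x.src = u ∧ x.tgt = v

/-- There is exactly one connected component: the vertex set is non-empty and any two vertices are
joined by a generalised path. -/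
def IsConnected : Prop := Nonempty E.Vertex ∧ ∀ u v, E.GenPath u v

/-- A rose is a weighted graph with exactly one vertex; its structured edges are its petals. -/
def IsRose : Prop := Nat.card E.Vertex = 1

/-- All weights are equal to `1`. -/
def IsUnweighted : Prop := ∀ α, E.weight α = 1

/-- An LV-graph: it has an edge, is connected, all weights are at least two, and at each vertex
which is not a sink the maximal weight is attained by at least two structured edges. -/
structure IsLVGraph : Prop where
  nonempty_stEdge : Nonempty E.StEdge
  connected : E.IsConnected
  two_le_weight : ∀ α, 2 ≤ E.weight α
  two_le_card : ∀ v, ¬ E.IsSink v →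
    2 ≤ ((E.outEdges v).filter fun α => E.weight α = E.maxWeight v).card

/-- An LV-rose is an LV-graph with exactly one vertex. -/
def IsLVRose : Prop := E.IsLVGraph ∧ E.IsRose

end WeightedGraph

/-- The free `R`-ring `R⟨X⟩`: the free left `R`-module on the non-empty words over `X`, with the
multiplication given by `(r x) (s y) = (r s) (x y)`. It has no unit in general. -/
abbrev FreeRRing (R : Type w) [Ring R] (X : Type u) : Type (max u w) :=
  MonoidAlgebra R (FreeSemigroup X)

namespace WeightedGraph

variable (R : Type w) [Ring R] (E : WeightedGraph.{u, v})

/-- A generator, as an element of `R⟨X⟩`. -/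
noncomputable def gen (x : E.Gen) : FreeRRing R E.Gen :=
  MonoidAlgebra.single (FreeSemigroup.of x) 1

/-- The vertex `v` in `R⟨X⟩`. -/
noncomputable def vtx (v : E.Vertex) : FreeRRing R E.Gen := E.gen R (.vertex v)

/-- The edge `α_{i+1}` in `R⟨X⟩`, which is zero if `i + 1 > ω(α)`. -/
noncomputable def edg (α : E.StEdge) (i : ℕ) : FreeRRing R E.Gen :=
  if h : i < E.weight α then E.gen R (.edge α ⟨i, h⟩) else 0

/-- The ghost edge `α_{i+1}*` in `R⟨X⟩`, which is zero if `i + 1 > ω(α)`. -/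
noncomputable def gst (α : E.StEdge) (i : ℕ) : FreeRRing R E.Gen :=
  if h : i < E.weight α then E.gen R (.ghost α ⟨i, h⟩) else 0

open Classical in
/-- The defining relations of the weighted Leavitt path algebra, as pairs (left-hand side,
right-hand side). -/
inductive Rel : FreeRRing R E.Gen → FreeRRing R E.Gen → Prop
  | vertex_mul_vertex (v w : E.Vertex) :
      Rel (E.vtx R v * E.vtx R w) (if v = w then E.vtx R v else 0)
  | source_mul_edge (α : E.StEdge) (i : ℕ) (hi : i < E.weight α) :
      Rel (E.vtx R (E.source α) * E.edg R α i) (E.edg R α i)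
  | edge_mul_range (α : E.StEdge) (i : ℕ) (hi : i < E.weight α) :
      Rel (E.edg R α i * E.vtx R (E.range α)) (E.edg R α i)
  | range_mul_ghost (α : E.StEdge) (i : ℕ) (hi : i < E.weight α) :
      Rel (E.vtx R (E.range α) * E.gst R α i) (E.gst R α i)
  | ghost_mul_source (α : E.StEdge) (i : ℕ) (hi : i < E.weight α) :
      Rel (E.gst R α i * E.vtx R (E.source α)) (E.gst R α i)
  | edge_mul_ghost (v : E.Vertex) (i j : ℕ) (hi : i < E.maxWeight v) (hj : j < E.maxWeight v) :
      Rel (∑ α ∈ E.outEdges v, E.edg R α i * E.gst R α j) (if i = j then E.vtx R v else 0)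
  | ghost_mul_edge (α β : E.StEdge) :
      Rel (∑ i ∈ Finset.range (max (E.weight α) (E.weight β)), E.gst R α i * E.edg R β i)
        (if α = β then E.vtx R (E.range α) else 0)

/-- The ideal of the `R`-ring `R⟨X⟩` generated by the defining relations: the smallest two-sided
ideal that is an `R`-subbimodule and contains all differences of the two sides of a relation. -/
noncomputable def relIdeal : TwoSidedIdeal (FreeRRing R E.Gen) :=
  sInf {I | (∀ a b, E.Rel R a b → a - b ∈ I) ∧
    ∀ (r : R), ∀ a ∈ I, r • a ∈ I ∧ MulOpposite.op r • a ∈ I}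

/-- The weighted Leavitt path algebra `L_R(E, ω)`, a ring that need not have a unit. -/
abbrev LeavittPathAlgebra : Type (max u v w) := (E.relIdeal R).ringCon.Quotient

end WeightedGraph

/-- A (not necessarily unital) ring is a domain if it is non-zero and has no zero divisors. -/
def IsRingDomain (A : Type w) [NonUnitalRing A] : Prop :=
  Nontrivial A ∧ ∀ a b : A, a * b = 0 → a = 0 ∨ b = 0

/-- The generators of the Leavitt algebra `L_R(n, m)`: the entries of an `n × m` matrix `Y` and of
an `m × n` matrix `X`. -/
inductive LeavittGen (n m : ℕ) : Type
  | y (i : Fin n) (j : Fin m) : LeavittGen n m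
  | x (j : Fin m) (i : Fin n) : LeavittGen n m

namespace LeavittAlgebra

variable (R : Type w) [Ring R] (n m : ℕ)

/-- The free unital `R`-ring on the generators; the coefficients commute with the generators. -/
abbrev Free : Type w := MonoidAlgebra R (FreeMonoid (LeavittGen n m))

/-- The matrix `Y` of generators. -/
noncomputable def matY : Matrix (Fin n) (Fin m) (Free R n m) :=
  fun i j => MonoidAlgebra.single (FreeMonoid.of (.y i j)) 1

/-- The matrix `X` of generators. -/
noncomputable def matX : Matrix (Fin m) (Fin n) (Free R n m) :=
  fun j i => MonoidAlgebra.single (FreeMonoid.of (.x j i)) 1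

/-- The defining relations, entrywise: `Y * X = 1` and `X * Y = 1`. -/
inductive Rel : Free R n m → Free R n m → Prop
  | matY_mul_matX (i i' : Fin n) :
      Rel ((matY R n m * matX R n m) i i') ((1 : Matrix (Fin n) (Fin n) (Free R n m)) i i')
  | matX_mul_matY (j j' : Fin m) :
      Rel ((matX R n m * matY R n m) j j') ((1 : Matrix (Fin m) (Fin m) (Free R n m)) j j')

end LeavittAlgebra

/-- The Leavitt algebra `L_R(n, m)`: the unital ring generated over `R` by the entries of `Y` and
`X`, subject to `Y * X = 1` and `X * Y = 1`. -/
abbrev LeavittAlgebra (R : Type w) [Ring R] (n m : ℕ) : Type w :=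
  RingQuot (LeavittAlgebra.Rel R n m)

/-! Sufficiency for LV-roses and for Leavitt algebras is one statement. In a rose of maximal weight
`N`, relations (3) and (4) say that the `N`-row matrix of edges and the matrix of ghost edges, both
with a prescribed pattern of zeros, are inverse to each other; in the Leavitt algebra the pattern
has no zeros. Both families are arrows of a bipartite graph joining indices to petals, and the
relations become `∑_q y_{pq} y_{qp'} = δ_{pp'}` for `p, p'` on the same side.

On each side fix a vertex adjacent to the whole other side: the index `0` and a petal of maximal
weight. The relation is solved for its term through this base `q`: `y_{pq} y_{qr} = δ_{pr} - ∑_{q' ≠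
q} y_{pq'} y_{q'r}`. Words without such a factor are normal. That they are linearly independent is
shown by letting the arrows act on the free module on the normal words (`isRep_act`). Its universal
property (`IsRep.orbit_act`) then identifies the algebra with this module
(`isRingDomain_of_action`).

For the absence of zero divisors (`orbit_act_ne_zero`), take words of maximal length in two nonzero
elements. If their concatenation is normal, its coefficient in the product is the product of the two
coefficients, unless a rewritten pair also contributes; then another choice of words works. If the
words meet at a base, rewriting produces the word through a second vertex adjacent to the whole
other side, with coefficient `-1`. Such a vertex exists because all weights are at least two and two
petals have maximal weight.

An unweighted rose with at most one petal embeds in the Laurent polynomials over `R`.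

Necessity rests on `smul_proj_gen_ne_zero`: nonzero multiples of generators are nonzero, by a
representation built from partitions of `ℕ`. Every excluded graph then has a relation stating that a
product of two generators is zero: two distinct vertices, or `α_1* β_1 = 0` if `α` has weight one,
or `α_N α_1* = 0` if `α` alone has the maximal weight `N ≥ 2`. -/

/-- A bipartite graph on `K` in which each of the two sides has a distinguished vertex that is
adjacent to all vertices of the other side. -/
structure PointedBipartite (K : Type*) where
  /-- the side of a vertex -/
  side : K → Bool
  /-- adjacency -/
  adj : K → K → Prop
  /-- the distinguished vertex of a side -/
  base : Bool → K
  adj_symm : ∀ {p q}, adj p q → adj q p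
  side_ne : ∀ {p q}, adj p q → side q ≠ side p
  side_base : ∀ b, side (base b) = b
  adj_base : ∀ {p b}, b ≠ side p → adj p (base b)

/-! ### Normal words and the representation on the free module they span. -/

namespace PointedBipartite

variable {K : Type*} (G : PointedBipartite K)

/-- The vertices on the side opposite to that of `p`. -/
noncomputable def opp [Fintype K] (p : K) : Finset K :=
  {q | G.side q ≠ G.side p}

theorem mem_opp [Fintype K] {p q : K} : q ∈ G.opp p ↔ G.side q ≠ G.side p := by
  simp [opp]

theorem opp_congr [Fintype K] {p p' : K} (h : G.side p = G.side p') : G.opp p = G.opp p' := by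
  simp [opp, h]

/-- The two-step walk `x y` backtracks through a distinguished vertex. -/
def Forbidden (x y : K × K) : Prop := x.2 = y.1 ∧ x.2 = G.base (G.side x.2)

/-- Sequences of arrows without forbidden pairs of consecutive arrows. -/
def Normal (l : List (K × K)) : Prop :=
  (∀ x ∈ l, G.adj x.1 x.2) ∧ l.IsChain fun x y => ¬ G.Forbidden x y

theorem normal_nil : G.Normal [] := ⟨by simp, .nil⟩

theorem normal_singleton {x : K × K} : G.Normal [x] ↔ G.adj x.1 x.2 := by
  simp [Normal]

theorem normal_cons_cons {x y : K × K} {l : List (K × K)} :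
    G.Normal (x :: y :: l) ↔ G.adj x.1 x.2 ∧ ¬ G.Forbidden x y ∧ G.Normal (y :: l) := by
  simp only [Normal, List.isChain_cons_cons, List.forall_mem_cons]
  tauto

variable {G} in
theorem Normal.tail {x : K × K} {l : List (K × K)} (h : G.Normal (x :: l)) : G.Normal l := by
  cases l with
  | nil => exact G.normal_nil
  | cons y l => exact (G.normal_cons_cons.1 h).2.2

variable {G} in
theorem Normal.adj_head {x : K × K} {l : List (K × K)} (h : G.Normal (x :: l)) :
    G.adj x.1 x.2 := h.1 x (by simp)

/-- Whether an arrow can be put in front of a normal sequence depends on its end only. -/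
theorem normal_cons_congr {p p' q : K} {l : List (K × K)} (h : G.Normal ((p', q) :: l))
    (hp : G.adj p q) : G.Normal ((p, q) :: l) := by
  cases l with
  | nil => exact G.normal_singleton.2 hp
  | cons y l =>
    rw [normal_cons_cons] at h ⊢
    exact ⟨hp, h.2⟩

/-- The type of normal sequences. -/
abbrev NormalForm : Type _ := {l : List (K × K) // G.Normal l}

section Model

variable (R : Type w) [Ring R]

/-- The free left module on the normal sequences. -/
abbrev Model : Type _ := G.NormalForm →₀ R

open Classical in
/-- The basis vector of a normal sequence, and zero for other sequences. -/
noncomputable def nf (l : List (K × K)) : G.Model R :=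
  if h : G.Normal l then Finsupp.single ⟨l, h⟩ 1 else 0

variable {R} in
theorem nf_of_normal {l : List (K × K)} (h : G.Normal l) :
    G.nf R l = Finsupp.single ⟨l, h⟩ 1 := dif_pos h

variable {R} in
theorem nf_of_not_normal {l : List (K × K)} (h : ¬ G.Normal l) : G.nf R l = 0 := dif_neg h

section WordAct

variable {R} {N : Type*} [AddCommGroup N] [Module R N] (y : K → K → N →ₗ[R] N)

/-- The composition of the operators along a sequence of arrows. -/
def wordAct : List (K × K) → N →ₗ[R] N
  | [] => LinearMap.id
  | x :: l => (y x.1 x.2).comp (wordAct l)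

theorem wordAct_append (l l' : List (K × K)) (n : N) :
    wordAct y (l ++ l') n = wordAct y l (wordAct y l' n) := by
  induction l with
  | nil => rfl
  | cons x l ih => exact congrArg (y x.1 x.2) ih

end WordAct

variable [Fintype K]

open Classical in
/-- The correction term in the product of an arrow and a normal sequence. -/
noncomputable def corr (p q : K) : List (K × K) → G.Model R
  | [] => 0
  | y :: l =>
    -- The word `(p, q) :: y :: l` is forbidden here and is replaced using the relation for `p` and
    -- `y.2`. Terms through a non-adjacent `q'` disappear because `nf` is zero on them.
    if q = y.1 ∧ q = G.base (G.side q) ∧ G.adj p q then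
      (if p = y.2 then G.nf R l else 0) -
        ∑ q' ∈ (G.opp p).erase q, G.nf R ((p, q') :: (q', y.2) :: l)
    else 0

/-- The action of an arrow on the free module on the normal sequences. -/
noncomputable def act (p q : K) : G.Model R →ₗ[R] G.Model R :=
  Finsupp.linearCombination R fun l => G.nf R ((p, q) :: l.1) + G.corr R p q l.1

variable {R}

theorem act_nf (p q : K) {l : List (K × K)} (h : G.Normal l) :
    G.act R p q (G.nf R l) = G.nf R ((p, q) :: l) + G.corr R p q l := by
  simp [act, nf_of_normal G h]

theorem act_single (p q : K) (l : G.NormalForm) (r : R) :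
    G.act R p q (Finsupp.single l r) = r • (G.nf R ((p, q) :: l.1) + G.corr R p q l.1) := by
  simp [act]

theorem corr_eq_zero {p q : K} {l : List (K × K)}
    (h : ∀ r l', l = (q, r) :: l' → q ≠ G.base (G.side q)) : G.corr R p q l = 0 := by
  match l with
  | [] => rfl
  | (q', r) :: l' =>
    simp only [corr]
    rw [if_neg]
    rintro ⟨rfl, h2, -⟩
    exact h _ _ rfl h2

theorem corr_eq_zero_of_normal {p q : K} {l : List (K × K)} (h : G.Normal ((p, q) :: l)) :
    G.corr R p q l = 0 := by
  refine G.corr_eq_zero fun r l' hl hq => ?_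
  subst hl
  exact (G.normal_cons_cons.1 h).2.1 ⟨rfl, hq⟩

/-- The correction sees only the vertex `q` at which the arrow meets the word, so any arrow ending
at `q` may witness normality; `(p, q)` itself need not be an arrow. -/
theorem corr_eq_zero_of_tail {p p' q : K} {l : List (K × K)} (h : G.Normal ((p', q) :: l)) :
    G.corr R p q l = 0 := by
  refine G.corr_eq_zero fun r l' hl hq => ?_
  subst hl
  exact (G.normal_cons_cons.1 h).2.1 ⟨rfl, hq⟩

theorem act_nf_of_normal {p q : K} {l : List (K × K)} (h : G.Normal ((p, q) :: l)) :
    G.act R p q (G.nf R l) = G.nf R ((p, q) :: l) := by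
  rw [G.act_nf p q h.tail, G.corr_eq_zero_of_normal h, add_zero]

theorem act_eq_zero {p q : K} (h : ¬ G.adj p q) : G.act R p q = 0 := by
  ext1 l
  ext1
  simp only [LinearMap.comp_apply, Finsupp.lsingle_apply, act_single, one_smul]
  rw [nf_of_not_normal G fun h' => h h'.adj_head]
  cases l.1 with
  | nil => simp [corr]
  | cons y l => simp [corr, h]

/-- A family of operators, indexed by arrows, that satisfies the Leavitt relations. -/
structure IsRep {N : Type*} [AddCommGroup N] [Module R N] (y : K → K → N →ₗ[R] N) : Prop where
  eq_zero : ∀ {p q}, ¬ G.adj p q → y p q = 0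
  sum_eq : ∀ {p p'}, G.side p = G.side p' → p = p' → ∀ n, ∑ q ∈ G.opp p, y p q (y q p' n) = n
  sum_eq_zero : ∀ {p p'}, G.side p = G.side p' → p ≠ p' → ∀ n,
    ∑ q ∈ G.opp p, y p q (y q p' n) = 0

open Classical in
theorem IsRep.sum_eq_ite {N : Type*} [AddCommGroup N] [Module R N] {y : K → K → N →ₗ[R] N}
    (hy : G.IsRep y) {p p' : K} (h : G.side p = G.side p') (n : N) :
    ∑ q ∈ G.opp p, y p q (y q p' n) = if p = p' then n else 0 := by
  split_ifs with hp
  · exact hy.sum_eq h hp n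
  · exact hy.sum_eq_zero h hp n

-- The hypothesis on the head of `l` makes the inner arrow attach without rewriting. Of the outer
-- arrows, only the one through the base is rewritten, and its correction cancels all other terms.
open Classical in
theorem sum_act_of_head {p p' : K} (h : G.side p = G.side p') {l : List (K × K)}
    (hl : G.Normal l) (hn : ∀ r l', l = (p', r) :: l' → p' ≠ G.base (G.side p')) :
    ∑ q ∈ G.opp p, G.act R p q (G.act R q p' (G.nf R l)) = if p = p' then G.nf R l else 0 := by
  have hnorm : ∀ q, G.adj q p' → G.Normal ((q, p') :: l) := by
    intro q hq
    cases l with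
    | nil => exact G.normal_singleton.2 hq
    | cons y l =>
      refine G.normal_cons_cons.2 ⟨hq, ?_, hl⟩
      rintro ⟨h1, h2⟩
      exact hn y.2 l (by rw [show p' = y.1 from h1]) h2
  have key : ∀ q ∈ G.opp p, G.act R p q (G.act R q p' (G.nf R l)) =
      G.nf R ((p, q) :: (q, p') :: l) +
        if q = G.base (G.side q) then (if p = p' then G.nf R l else 0) -
        ∑ q' ∈ (G.opp p).erase q, G.nf R ((p, q') :: (q', p') :: l) else 0 := by
    intro q hq
    by_cases hqp : G.adj q p'
    · rw [G.act_nf_of_normal (hnorm q hqp), G.act_nf _ _ (hnorm q hqp)]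
      congr 1
      simp only [corr]
      by_cases hb : q = G.base (G.side q)
      · rw [if_pos, if_pos hb]
        refine ⟨trivial, hb, ?_⟩
        rw [hb]
        exact G.adj_base (G.mem_opp.1 hq)
      · rw [if_neg hb, if_neg fun h' => hb h'.2.1]
    · rw [G.act_eq_zero hqp, if_neg, nf_of_not_normal _ fun h' => hqp h'.tail.adj_head]
      · simp
      · intro hb
        refine hqp (G.adj_symm ?_)
        rw [hb]
        exact G.adj_base (h ▸ G.mem_opp.1 hq)
  have hd : G.base (!G.side p) ∈ G.opp p := by simp [mem_opp, side_base]
  -- The base is the only `q` with a correction term, and the plain word through it is not normal,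
  -- so the two remaining sums over `q' ≠` base cancel.
  rw [Finset.sum_congr rfl key, Finset.sum_add_distrib,
    Finset.sum_eq_single_of_mem (f := fun q => ite _ _ _) _ hd, if_pos (by rw [side_base]),
    ← Finset.add_sum_erase _ _ hd, nf_of_not_normal]
  · abel
  · intro h'
    exact (G.normal_cons_cons.1 h').2.1 ⟨rfl, by rw [side_base]⟩
  · intro q hq hne
    rw [if_neg]
    intro hb
    apply hne
    rw [hb]
    congr 1
    have := G.mem_opp.1 hq
    revert this
    cases G.side q <;> cases G.side p <;> simp

/-- This takes the place of the diamond lemma: the case not covered by `sum_act_of_head` is the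
overlap of two rewritings, where the inner arrow meets `l` at a base. -/
theorem isRep_act : G.IsRep (G.act R) := by
  classical
  have key : ∀ {p p'}, G.side p = G.side p' → ∀ l, G.Normal l →
      ∑ q ∈ G.opp p, G.act R p q (G.act R q p' (G.nf R l)) =
        if p = p' then G.nf R l else 0 := by
    intro p p' h l hl
    by_cases hn : ∀ r l', l = (p', r) :: l' → p' ≠ G.base (G.side p')
    · exact G.sum_act_of_head h hl hn
    push Not at hn
    obtain ⟨r, l', rfl, hb⟩ := hn
    have hadj : G.adj p' r := hl.adj_head
    have hr : r ∈ G.opp p := G.mem_opp.2 (h ▸ G.side_ne hadj)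
    -- A side has only one base, so `p''` is not a base and `sum_act_of_head` applies to words
    -- starting at `p''`.
    have hrow : ∀ p'', G.side p = G.side p'' → p'' ≠ p' →
        ∑ q ∈ G.opp p, G.act R p q (G.nf R ((q, p'') :: (p'', r) :: l')) =
          if p = p'' then G.nf R ((p'', r) :: l') else 0 := by
      intro p'' hs hne
      have hb'' : p'' ≠ G.base (G.side p'') := by rwa [← hs, h, ← hb]
      by_cases hn : G.Normal ((p'', r) :: l')
      · rw [← G.sum_act_of_head hs hn fun _ _ _ => hb'']
        refine Finset.sum_congr rfl fun q hq => ?_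
        by_cases hqp : G.adj q p''
        · rw [G.act_nf_of_normal (p := q)]
          exact G.normal_cons_cons.2 ⟨hqp, fun h' => hb'' h'.2, hn⟩
        · rw [G.act_eq_zero hqp, nf_of_not_normal _ fun h' => hqp h'.adj_head]
          simp
      · rw [nf_of_not_normal _ hn, ite_self]
        refine Finset.sum_eq_zero fun q hq => ?_
        rw [nf_of_not_normal _ fun h' => hn h'.tail, map_zero]
    have step : ∀ q ∈ G.opp p, G.act R p q (G.act R q p' (G.nf R ((p', r) :: l'))) =
        (if q = r then G.act R p q (G.nf R l') else 0) -
        ∑ p'' ∈ (G.opp r).erase p', G.act R p q (G.nf R ((q, p'') :: (p'', r) :: l')) := by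
      intro q hq
      have hqr : G.opp q = G.opp r := by
        apply G.opp_congr
        have h1 := G.mem_opp.1 hq
        have h2 := G.mem_opp.1 hr
        revert h1 h2
        cases G.side q <;> cases G.side p <;> cases G.side r <;> simp
      have hqp : G.adj q p' := by
        rw [hb]
        exact G.adj_base fun h' => G.mem_opp.1 hq (by rw [← h', h])
      rw [G.act_nf _ _ hl, nf_of_not_normal, zero_add]
      · simp only [corr]
        rw [if_pos ⟨trivial, hb, hqp⟩, hqr, map_sub, map_sum]
        congr 1
        split_ifs <;> simp
      · exact fun h' => (G.normal_cons_cons.1 h').2.1 ⟨rfl, hb⟩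
    rw [Finset.sum_congr rfl step, Finset.sum_sub_distrib, Finset.sum_ite_eq' , if_pos hr,
      Finset.sum_comm, G.act_nf _ _ hl.tail, G.corr_eq_zero_of_tail hl, add_zero]
    have hside : ∀ p'' ∈ (G.opp r).erase p', G.side p = G.side p'' := by
      intro p'' hp''
      have h1 := G.mem_opp.1 (Finset.mem_of_mem_erase hp'')
      have h2 := G.mem_opp.1 hr
      revert h1 h2
      cases G.side p'' <;> cases G.side p <;> cases G.side r <;> simp
    rw [Finset.sum_congr rfl fun p'' hp'' =>
      hrow p'' (hside p'' hp'') (Finset.ne_of_mem_erase hp''), Finset.sum_ite_eq]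
    -- What is left is the word `(p, r) :: l'` minus the term `p'' = p` of a sum over `p'' ≠ p'`:
    -- they cancel unless `p = p'`, when that term is missing.
    by_cases hpp : p = p'
    · subst hpp
      simp
    · rw [if_neg hpp, if_pos, sub_self]
      refine Finset.mem_erase.2 ⟨hpp, G.mem_opp.2 fun h' => G.mem_opp.1 hr h'.symm⟩
  have key' : ∀ {p p'}, G.side p = G.side p' →
      ∑ q ∈ G.opp p, (G.act R p q).comp (G.act R q p') =
        if p = p' then LinearMap.id else 0 := by
    intro p p' h
    ext1 l
    ext1
    have := key h l.1 l.2
    rw [nf_of_normal G l.2] at this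
    simp only [LinearMap.comp_apply, Finsupp.lsingle_apply, LinearMap.sum_apply]
    rw [this]
    split_ifs <;> simp
  refine ⟨G.act_eq_zero, fun h hp n => ?_, fun h hp n => ?_⟩
  · have := LinearMap.congr_fun (key' h) n
    simpa [LinearMap.sum_apply, hp] using this
  · have := LinearMap.congr_fun (key' h) n
    simpa [LinearMap.sum_apply, hp] using this

section Universal

variable {N : Type*} [AddCommGroup N] [Module R N] (y : K → K → N →ₗ[R] N)

/-- The map from the free module on the normal sequences determined by a vector. -/
noncomputable def orbit (n : N) : G.Model R →ₗ[R] N :=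
  Finsupp.linearCombination R fun l => wordAct y l.1 n

variable {G y}

/-- A forbidden word of genuine arrows must be excluded: `nf` is zero on it while its operator need
not be. With a non-arrow in the word both sides vanish. -/
theorem IsRep.orbit_nf (hy : G.IsRep y) (n : N) {l : List (K × K)}
    (h : G.Normal l ∨ ∃ x ∈ l, ¬ G.adj x.1 x.2) :
    G.orbit y n (G.nf R l) = wordAct y l n := by
  by_cases hl : G.Normal l
  · simp [nf_of_normal G hl, orbit]
  · obtain ⟨x, hx, hadj⟩ := h.resolve_left hl
    rw [nf_of_not_normal G hl, map_zero]
    clear h hl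
    induction l with
    | nil => simp at hx
    | cons z l ih =>
      rcases List.mem_cons.1 hx with rfl | hx
      · rw [wordAct, hy.eq_zero hadj, LinearMap.zero_comp, LinearMap.zero_apply]
      · rw [wordAct, LinearMap.comp_apply, ← ih hx, map_zero]

theorem IsRep.orbit_act (hy : G.IsRep y) (n : N) (p q : K) (m : G.Model R) :
    G.orbit y n (G.act R p q m) = y p q (G.orbit y n m) := by
  classical
  have key : ∀ l, G.Normal l →
      G.orbit y n (G.act R p q (G.nf R l)) = y p q (G.orbit y n (G.nf R l)) := by
    intro l hl
    rw [hy.orbit_nf n (Or.inl hl)]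
    by_cases hadj : G.adj p q
    swap
    · rw [G.act_eq_zero hadj, hy.eq_zero hadj]
      simp
    by_cases hn : G.Normal ((p, q) :: l)
    · rw [G.act_nf_of_normal hn, hy.orbit_nf n (Or.inl hn), wordAct, LinearMap.comp_apply]
    cases l with
    | nil => exact absurd (G.normal_singleton.2 hadj) hn
    | cons x l =>
      obtain ⟨q', r⟩ := x
      have hf : G.Forbidden (p, q) (q', r) := by
        by_contra hf
        exact hn (G.normal_cons_cons.2 ⟨hadj, hf, hl⟩)
      obtain ⟨h1, hb⟩ := hf
      obtain rfl : q = q' := h1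
      replace hb : q = G.base (G.side q) := hb
      have hqr : G.adj q r := hl.adj_head
      rw [G.act_nf _ _ hl, nf_of_not_normal G hn, zero_add]
      simp only [corr]
      rw [if_pos ⟨trivial, hb, hadj⟩, map_sub, map_sum]
      have hs : G.side p = G.side r := by
        have h1 := G.side_ne hadj
        have h2 := G.side_ne hqr
        revert h1 h2
        cases G.side p <;> cases G.side q <;> cases G.side r <;> simp
      have hq : q ∈ G.opp p := G.mem_opp.2 (G.side_ne hadj)
      have hterm : ∀ q' ∈ (G.opp p).erase q,
          G.orbit y n (G.nf R ((p, q') :: (q', r) :: l)) =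
            y p q' (y q' r (wordAct y l n)) := by
        intro q' hq'
        rw [hy.orbit_nf n]
        · rfl
        by_cases h1 : G.adj p q'
        · by_cases h2 : G.adj q' r
          · left
            refine G.normal_cons_cons.2 ⟨h1, ?_, G.normal_cons_congr hl h2⟩
            rintro ⟨-, h3⟩
            refine Finset.ne_of_mem_erase hq' (?_ : q' = q)
            replace h3 : q' = G.base (G.side q') := h3
            rw [h3, hb]
            congr 1
            have h4 := G.side_ne h1
            have h5 := G.side_ne hadj
            revert h4 h5
            cases G.side p <;> cases G.side q <;> cases G.side q' <;> simp
          · exact Or.inr ⟨(q', r), by simp, h2⟩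
        · exact Or.inr ⟨(p, q'), by simp, h1⟩
      rw [Finset.sum_congr rfl hterm]
      -- The relation in `N`, solved for its term through the base `q`, matches the definition of
      -- the correction.
      have := IsRep.sum_eq_ite G hy hs (wordAct y l n)
      rw [← Finset.add_sum_erase _ _ hq] at this
      rw [apply_ite (G.orbit y n), hy.orbit_nf n (Or.inl hl.tail), map_zero, ← this]
      simp [wordAct]
  have key' : (G.orbit y n).comp (G.act R p q) = (y p q).comp (G.orbit y n) := by
    ext1 l
    ext1
    have := key l.1 l.2
    rw [nf_of_normal G l.2] at this
    simpa using this
  exact LinearMap.congr_fun key' m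

theorem IsRep.orbit_nil (hy : G.IsRep y) (n : N) : G.orbit y n (G.nf R []) = n :=
  hy.orbit_nf n (Or.inl G.normal_nil)

end Universal

end Model

end PointedBipartite

/-! ### Leading words and the absence of zero divisors. -/

namespace PointedBipartite

variable {K : Type*} (G : PointedBipartite K)

theorem normal_append {l l' : List (K × K)} :
    G.Normal (l ++ l') ↔ G.Normal l ∧ G.Normal l' ∧
      ∀ x ∈ l.getLast?, ∀ y ∈ l'.head?, ¬ G.Forbidden x y := by
  simp only [Normal, List.isChain_append, List.forall_mem_append]
  tauto

/-- If the concatenation of two normal sequences is not normal, then this is due to a forbidden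
pair at the junction. -/
theorem exists_of_not_normal_append {l l' : List (K × K)} (hl : G.Normal l) (hl' : G.Normal l')
    (h : ¬ G.Normal (l ++ l')) :
    ∃ a p q r b, l = a ++ [(p, q)] ∧ l' = (q, r) :: b ∧ q = G.base (G.side q) := by
  rw [normal_append] at h
  push Not at h
  obtain ⟨⟨p, q⟩, hx, ⟨q', r⟩, hy, h1, h2⟩ := h hl hl'
  obtain rfl : q = q' := h1
  obtain ⟨a, rfl⟩ := List.getLast?_eq_some_iff.1 hx
  obtain ⟨b, rfl⟩ := List.head?_eq_some_iff.1 hy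
  exact ⟨a, p, q, r, b, rfl, rfl, h2⟩

theorem Normal.append_arrow {p q q' : K} {a : List (K × K)} (h : G.Normal (a ++ [(p, q)]))
    (hq : G.adj p q') : G.Normal (a ++ [(p, q')]) := by
  rw [normal_append, normal_singleton] at h ⊢
  refine ⟨h.1, hq, fun x hx y hy => ?_⟩
  obtain rfl : (p, q') = y := by simpa using hy
  exact h.2.2 x hx (p, q) (by simp)

theorem normal_junction {p q q' r : K} {a b : List (K × K)} (h : G.Normal (a ++ [(p, q)]))
    (h' : G.Normal ((q', r) :: b)) (hne : q ≠ q' ∨ q' ≠ G.base (G.side q')) :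
    G.Normal ((a ++ [(p, q)]) ++ (q', r) :: b) := by
  refine G.normal_append.2 ⟨h, h', ?_⟩
  rintro x hx y hy ⟨h1, h2⟩
  obtain rfl : (p, q) = x := by simpa using hx
  obtain rfl : (q', r) = y := by simpa using hy
  replace h1 : q = q' := h1
  subst h1
  exact hne.elim (fun h3 => h3 rfl) fun h3 => h3 h2

section Length

variable {R : Type w} [Ring R]

theorem nf_apply_of_ne {l : List (K × K)} {z : G.NormalForm} (h : l ≠ z.1) : G.nf R l z = 0 := by
  classical
  by_cases hl : G.Normal l
  · rw [nf_of_normal G hl, Finsupp.single_apply, if_neg]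
    rintro rfl
    exact h rfl
  · rw [nf_of_not_normal G hl, Finsupp.zero_apply]

theorem nf_apply_self (z : G.NormalForm) : G.nf R z.1 z = 1 := by
  rw [nf_of_normal G z.2, Finsupp.single_eq_same]

variable (R) in
/-- The vectors supported on sequences of length at most `k`. -/
noncomputable def lengthLE (k : ℕ) : Submodule R (G.Model R) :=
  Finsupp.supported R R {l : G.NormalForm | l.1.length ≤ k}

theorem nf_mem_lengthLE {l : List (K × K)} {k : ℕ} (h : l.length ≤ k) :
    G.nf R l ∈ G.lengthLE R k := by
  by_cases hl : G.Normal l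
  · rw [nf_of_normal G hl]
    exact Finsupp.single_mem_supported R 1 h
  · rw [nf_of_not_normal G hl]
    exact zero_mem _

theorem apply_eq_zero_of_mem_lengthLE {m : G.Model R} {k : ℕ} (hm : m ∈ G.lengthLE R k)
    {z : G.NormalForm} (hz : k < z.1.length) : m z = 0 := by
  by_contra h
  exact absurd ((Finsupp.mem_supported R m).1 hm (Finsupp.mem_support_iff.2 h)) (not_le.2 hz)

/-- A nonzero vector has a nonzero coefficient of maximal length. -/
theorem exists_leading {m : G.Model R} (hm : m ≠ 0) :
    ∃ l, m l ≠ 0 ∧ m ∈ G.lengthLE R l.1.length := by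
  obtain ⟨l, hl, hmax⟩ := m.support.exists_max_image (fun l => l.1.length)
    (Finsupp.support_nonempty_iff.2 hm)
  exact ⟨l, Finsupp.mem_support_iff.1 hl, (Finsupp.mem_supported R m).2 fun l' hl' => hmax l' hl'⟩

variable [Fintype K]

/-- Rewriting never lengthens a word: a forbidden pair is replaced by pairs, or deleted. -/
theorem act_mem_lengthLE (p q : K) {m : G.Model R} {k : ℕ} (hm : m ∈ G.lengthLE R k) :
    G.act R p q m ∈ G.lengthLE R (k + 1) := by
  classical
  rw [lengthLE, Finsupp.supported_eq_span_single] at hm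
  induction hm using Submodule.span_induction with
  | mem x hx =>
    obtain ⟨l, hl, rfl⟩ := hx
    replace hl : l.1.length ≤ k := hl
    rw [act_single, one_smul]
    refine add_mem (G.nf_mem_lengthLE (by simpa using hl)) ?_
    generalize l.1 = l at hl
    cases l with
    | nil => exact zero_mem _
    | cons y l =>
      simp only [List.length_cons] at hl
      simp only [corr]
      split_ifs
      · exact sub_mem (G.nf_mem_lengthLE (by omega))
          (sum_mem fun q _ => G.nf_mem_lengthLE (by simp; omega))
      · exact sub_mem (zero_mem _) (sum_mem fun q _ => G.nf_mem_lengthLE (by simp; omega))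
      · exact zero_mem _
  | zero => rw [map_zero]; exact zero_mem _
  | add x y _ _ hx hy => rw [map_add]; exact add_mem hx hy
  | smul r x _ hx => rw [map_smul]; exact Submodule.smul_mem _ r hx

theorem wordAct_mem_lengthLE (l : List (K × K)) {m : G.Model R} {k : ℕ}
    (hm : m ∈ G.lengthLE R k) : wordAct (G.act R) l m ∈ G.lengthLE R (l.length + k) := by
  induction l with
  | nil => simpa [wordAct] using hm
  | cons x l ih =>
    have := G.act_mem_lengthLE x.1 x.2 ih
    rw [List.length_cons, Nat.add_right_comm]
    exact this

theorem wordAct_nf_of_normal {l l' : List (K × K)} (h : G.Normal (l ++ l')) :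
    wordAct (G.act R) l (G.nf R l') = G.nf R (l ++ l') := by
  induction l with
  | nil => rfl
  | cons x l ih =>
    rw [wordAct, LinearMap.comp_apply, ih h.tail]
    exact G.act_nf_of_normal h

-- In top length one rewriting at the junction suffices. The new pair keeps the outer ends `p` and
-- `r`, so the junctions with `a` and `b` are unchanged, and its middle vertex is no longer a base.
open Classical in
theorem wordAct_nf_of_forbidden {p q r : K} {a b : List (K × K)} (h : G.Normal (a ++ [(p, q)]))
    (h' : G.Normal ((q, r) :: b)) (hq : q = G.base (G.side q)) {z : G.NormalForm}
    (hz : z.1.length = a.length + b.length + 2) :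
    wordAct (G.act R) (a ++ [(p, q)]) (G.nf R ((q, r) :: b)) z =
      - ∑ q' ∈ (G.opp p).erase q, G.nf R (a ++ (p, q') :: (q', r) :: b) z := by
  have hpq : G.adj p q := G.normal_singleton.1 (G.normal_append.1 h).2.1
  have hterm : ∀ q' ∈ (G.opp p).erase q,
      wordAct (G.act R) a (G.nf R ((p, q') :: (q', r) :: b)) =
        G.nf R (a ++ (p, q') :: (q', r) :: b) := by
    intro q' hq'
    by_cases hn : G.Normal ((p, q') :: (q', r) :: b)
    · refine G.wordAct_nf_of_normal ?_
      have h1 := h.append_arrow G hn.adj_head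
      refine G.normal_append.2 ⟨(G.normal_append.1 h).1, hn, fun x hx y hy => ?_⟩
      obtain rfl : (p, q') = y := by simpa using hy
      exact (G.normal_append.1 h1).2.2 x hx _ (by simp)
    · rw [nf_of_not_normal G hn, map_zero, nf_of_not_normal]
      exact fun h1 => hn (G.normal_append.1 h1).2.1
  rw [wordAct_append]
  change wordAct (G.act R) a (G.act R p q _) z = _
  rw [G.act_nf _ _ h', nf_of_not_normal, zero_add]
  · simp only [corr]
    rw [if_pos ⟨trivial, hq, hpq⟩, map_sub, map_sum]
    have hlow : wordAct (G.act R) a (if p = r then G.nf R b else 0) z = 0 := by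
      refine G.apply_eq_zero_of_mem_lengthLE (G.wordAct_mem_lengthLE a (k := b.length) ?_)
        (by omega)
      split_ifs
      · exact G.nf_mem_lengthLE le_rfl
      · exact zero_mem _
    rw [Finsupp.sub_apply, hlow, zero_sub, Finsupp.finsetSum_apply]
    congr 1
    exact Finset.sum_congr rfl fun q' hq' => by rw [← hterm q' hq']
  · exact fun h1 => (G.normal_cons_cons.1 h1).2.1 ⟨rfl, hq⟩

end Length

/-- Each side has a vertex that is not the distinguished one and is adjacent to all vertices of the
other side. -/
def HasSecondBase : Prop :=
  ∀ b, ∃ q, G.side q = b ∧ q ≠ G.base b ∧ ∀ p, b ≠ G.side p → G.adj p q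

section Domain

variable [Fintype K] {R : Type w} [Ring R]

/-- Under the identification of the module with the algebra, `G.orbit (G.act R) n m` is the product
of `m` and `n`. -/
theorem orbit_act_apply (m n : G.Model R) (z : G.NormalForm) :
    G.orbit (G.act R) n m z = m.sum fun l c => c * n.sum fun l' d =>
      d * wordAct (G.act R) l.1 (G.nf R l'.1) z := by
  rw [orbit, Finsupp.linearCombination_apply, Finsupp.sum, Finsupp.finsetSum_apply, Finsupp.sum]
  refine Finset.sum_congr rfl fun l _ => ?_
  rw [Finsupp.smul_apply, smul_eq_mul]
  congr 1
  have : n = n.sum fun l' d => d • G.nf R l'.1 := by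
    conv_lhs => rw [← Finsupp.sum_single n]
    exact Finsupp.sum_congr fun l' _ => by rw [nf_of_normal G l'.2]; simp
  conv_lhs => rw [this]
  rw [Finsupp.sum, map_sum, Finsupp.finsetSum_apply, Finsupp.sum]
  exact Finset.sum_congr rfl fun l' _ => by simp

/-- The coefficient of a product at a sequence of maximal length to which only one pair
contributes. -/
theorem orbit_act_apply_of_unique {m n : G.Model R} {l l' z : G.NormalForm}
    (hm : m ∈ G.lengthLE R l.1.length) (hn : n ∈ G.lengthLE R l'.1.length)
    (hz : z.1.length = l.1.length + l'.1.length)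
    (huniq : ∀ k k' : G.NormalForm, m k ≠ 0 → n k' ≠ 0 → k.1.length = l.1.length →
      k'.1.length = l'.1.length → wordAct (G.act R) k.1 (G.nf R k'.1) z ≠ 0 → k = l ∧ k' = l') :
    G.orbit (G.act R) n m z = m l * (n l' * wordAct (G.act R) l.1 (G.nf R l'.1) z) := by
  have hterm : ∀ k k' : G.NormalForm, (k ≠ l ∨ k' ≠ l') →
      m k * (n k' * wordAct (G.act R) k.1 (G.nf R k'.1) z) = 0 := by
    intro k k' hne
    by_cases h1 : m k = 0
    · simp [h1]
    by_cases h2 : n k' = 0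
    · simp [h2]
    by_cases h3 : wordAct (G.act R) k.1 (G.nf R k'.1) z = 0
    · simp [h3]
    have hk : k.1.length ≤ l.1.length := by
      by_contra h
      exact h1 (G.apply_eq_zero_of_mem_lengthLE hm (not_le.1 h))
    have hk' : k'.1.length ≤ l'.1.length := by
      by_contra h
      exact h2 (G.apply_eq_zero_of_mem_lengthLE hn (not_le.1 h))
    have hkz : z.1.length ≤ k.1.length + k'.1.length := by
      by_contra h
      exact h3 (G.apply_eq_zero_of_mem_lengthLE
        (G.wordAct_mem_lengthLE k.1 (G.nf_mem_lengthLE le_rfl)) (not_le.1 h))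
    have := huniq k k' h1 h2 (by omega) (by omega) h3
    tauto
  rw [orbit_act_apply, Finsupp.sum, Finset.sum_eq_single l]
  · rw [Finsupp.sum, Finset.mul_sum, Finset.sum_eq_single l']
    · intro k' _ hk'
      exact hterm l k' (Or.inr hk')
    · intro h
      simp [Finsupp.notMem_support_iff.1 h]
  · intro k _ hk
    rw [Finsupp.sum, Finset.mul_sum]
    exact Finset.sum_eq_zero fun k' _ => hterm k k' (Or.inl hk)
  · intro h
    simp [Finsupp.notMem_support_iff.1 h]

/-- The pairs of normal sequences whose product involves a given sequence of maximal length. -/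
theorem eq_or_exists_of_wordAct_apply_ne_zero {k k' : G.NormalForm} {z : G.NormalForm}
    (hz : z.1.length = k.1.length + k'.1.length)
    (h : wordAct (G.act R) k.1 (G.nf R k'.1) z ≠ 0) :
    z.1 = k.1 ++ k'.1 ∨ ∃ a p q q' r b, k.1 = a ++ [(p, q)] ∧ k'.1 = (q, r) :: b ∧
      q = G.base (G.side q) ∧ q' ≠ q ∧ z.1 = a ++ (p, q') :: (q', r) :: b := by
  classical
  by_cases hn : G.Normal (k.1 ++ k'.1)
  · left
    by_contra hne
    rw [G.wordAct_nf_of_normal hn] at h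
    exact h (G.nf_apply_of_ne fun h' => hne h'.symm)
  · right
    obtain ⟨a, p, q, r, b, h1, h2, hq⟩ := G.exists_of_not_normal_append k.2 k'.2 hn
    rw [h1, h2] at hz
    rw [h1, h2, G.wordAct_nf_of_forbidden (h1 ▸ k.2) (h2 ▸ k'.2) hq (by simp at hz ⊢; omega)] at h
    obtain ⟨q', hq', h3⟩ := Finset.exists_ne_zero_of_sum_ne_zero (neg_ne_zero.1 h)
    refine ⟨a, p, q, q', r, b, h1, h2, hq, Finset.ne_of_mem_erase hq', ?_⟩
    by_contra hne
    exact h3 (G.nf_apply_of_ne fun h' => hne h'.symm)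

/-- The product of two vectors with a pair of leading sequences that meet normally and do not
match. -/
theorem orbit_act_ne_zero_of_normal [NoZeroDivisors R] {m n : G.Model R} {l l' : G.NormalForm}
    (hm : m ∈ G.lengthLE R l.1.length) (hn : n ∈ G.lengthLE R l'.1.length)
    (hl : m l ≠ 0) (hl' : n l' ≠ 0) (hnorm : G.Normal (l.1 ++ l'.1))
    (hmatch : ∀ a p q r b, l.1 = a ++ [(p, q)] → l'.1 = (q, r) :: b →
      ∀ k k' : G.NormalForm, m k ≠ 0 → n k' ≠ 0 →
      k.1 ≠ a ++ [(p, G.base (G.side q))] ∨ k'.1 ≠ (G.base (G.side q), r) :: b) :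
    G.orbit (G.act R) n m ≠ 0 := by
  intro h0
  have h1 := G.orbit_act_apply_of_unique (z := ⟨_, hnorm⟩) hm hn (by simp) ?_
  · rw [h0, G.wordAct_nf_of_normal hnorm, G.nf_apply_self ⟨_, hnorm⟩, mul_one] at h1
    exact mul_ne_zero hl hl' h1.symm
  intro k k' hk hk' hlen hlen' hne
  rcases G.eq_or_exists_of_wordAct_apply_ne_zero (by simp [hlen, hlen']) hne with h2 | h2
  · have := List.append_inj h2 hlen.symm
    exact ⟨Subtype.ext this.1.symm, Subtype.ext this.2.symm⟩
  · obtain ⟨a, p, q, q', r, b, e1, e2, hq, hqq, e3⟩ := h2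
    exfalso
    replace e3 : l.1 ++ l'.1 = (a ++ [(p, q')]) ++ ((q', r) :: b) := by simpa using e3
    obtain ⟨e4, e5⟩ := List.append_inj e3 (by rw [← hlen, e1]; simp)
    have hside : G.side q' = G.side q := by
      have h1 : G.adj p q := G.normal_singleton.1 (G.normal_append.1 (e1 ▸ k.2)).2.1
      have h2 : G.adj p q' := G.normal_singleton.1 (G.normal_append.1 (e4 ▸ l.2)).2.1
      have h1 := G.side_ne h1
      have h2 := G.side_ne h2
      revert h1 h2
      cases G.side p <;> cases G.side q <;> cases G.side q' <;> simp
    have := hmatch a p q' r b e4 e5 k k' hk hk'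
    rw [hside, ← hq] at this
    tauto

theorem orbit_act_ne_zero [NoZeroDivisors R] (hG : G.HasSecondBase) {m n : G.Model R}
    (hm : m ≠ 0) (hn : n ≠ 0) : G.orbit (G.act R) n m ≠ 0 := by
  classical
  obtain ⟨l, hl, hml⟩ := G.exists_leading hm
  obtain ⟨l', hl', hnl⟩ := G.exists_leading hn
  -- A pair of leading sequences that meet at different vertices settles the claim.
  have hdiff : ∀ (k k' : G.NormalForm) (a b : List (K × K)) (p q q' r : K), m k ≠ 0 → n k' ≠ 0 →
      k.1.length = l.1.length → k'.1.length = l'.1.length → k.1 = a ++ [(p, q)] →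
      k'.1 = (q', r) :: b → q ≠ q' → G.orbit (G.act R) n m ≠ 0 := by
    intro k k' a b p q q' r hk hk' hlen hlen' e1 e2 hne
    refine G.orbit_act_ne_zero_of_normal (hlen ▸ hml) (hlen' ▸ hnl) hk hk' ?_ ?_
    · rw [e1, e2]
      exact G.normal_junction (e1 ▸ k.2) (e2 ▸ k'.2) (Or.inl hne)
    · intro a' p1 q1 r1 b' e3 e4
      rw [e1] at e3
      rw [e2] at e4
      simp only [List.append_singleton_inj, Prod.mk.injEq, List.cons.injEq] at e3 e4
      exact absurd (e3.2.2.trans e4.1.1.symm) hne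
  by_cases hnorm : G.Normal (l.1 ++ l'.1)
  · by_cases hmatch : ∀ a p q r b, l.1 = a ++ [(p, q)] → l'.1 = (q, r) :: b →
        ∀ k k' : G.NormalForm, m k ≠ 0 → n k' ≠ 0 →
        k.1 ≠ a ++ [(p, G.base (G.side q))] ∨ k'.1 ≠ (G.base (G.side q), r) :: b
    · exact G.orbit_act_ne_zero_of_normal hml hnl hl hl' hnorm hmatch
    · push Not at hmatch
      -- A competing rewritten pair supplies a word `k'` of `n` starting at the base, whereas `l`
      -- ends at `q`, which is not the base since `l ++ l'` is normal. So `l` and `k'` meet at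
      -- different vertices.
      obtain ⟨a, p, q, r, b, e1, e2, k, k', -, hk', -, e3⟩ := hmatch
      refine hdiff l k' a b p q _ r hl hk' rfl (by rw [e2, e3]; simp) e1 e3 fun hq => ?_
      rw [e1, e2] at hnorm
      refine (G.normal_append.1 hnorm).2.2 (p, q) (by simp) (q, r) (by simp) ⟨rfl, hq⟩
  · obtain ⟨a, p, q, r, b, e1, e2, hq⟩ := G.exists_of_not_normal_append l.2 l'.2 hnorm
    -- Rewriting the junction at `q` yields the word through the second base `s`, which is normal
    -- since `s` is adjacent to both `p` and `r`.
    obtain ⟨s, hs, hsne, hadj⟩ := hG (G.side q)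
    have hpq : G.adj p q := G.normal_singleton.1 (G.normal_append.1 (e1 ▸ l.2)).2.1
    have hqr : G.adj q r := (e2 ▸ l'.2 : G.Normal ((q, r) :: b)).adj_head
    have hps : G.adj p s := hadj p (G.side_ne hpq)
    have hsr : G.adj s r := G.adj_symm (hadj r (G.side_ne hqr).symm)
    have hz : G.Normal ((a ++ [(p, s)]) ++ (s, r) :: b) :=
      G.normal_junction ((e1 ▸ l.2 : G.Normal (a ++ [(p, q)])).append_arrow G hps)
        (G.normal_cons_congr (e2 ▸ l'.2) hsr) (Or.inr (by rwa [hs]))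
    rw [← hq] at hsne
    by_cases hms : m ⟨_, (G.normal_append.1 hz).1⟩ = 0
    swap
    · exact hdiff _ l' a b p s q r hms hl' (by rw [e1]; simp) rfl rfl e2 hsne
    intro h0
    have h1 := G.orbit_act_apply_of_unique (z := ⟨_, hz⟩) hml hnl (by rw [e1, e2]; simp; omega) ?_
    · rw [h0, e1, e2, G.wordAct_nf_of_forbidden (e1 ▸ l.2) (e2 ▸ l'.2) hq
        (by simp; omega), Finset.sum_eq_single s] at h1
      · have h2 := G.nf_apply_self (R := R) ⟨_, hz⟩
        simp only [List.append_assoc, List.singleton_append] at h2 h1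
        rw [h2, Finsupp.zero_apply, mul_neg_one, mul_neg, eq_comm, neg_eq_zero] at h1
        exact mul_ne_zero hl hl' h1
      · intro s' _ hss
        refine G.nf_apply_of_ne fun h' => hss ?_
        simpa using h'
      · intro h'
        exact absurd (Finset.mem_erase.2 ⟨hsne, G.mem_opp.2 (G.side_ne hps)⟩) h'
    intro k k' hk hk' hlen hlen' hne
    have hlz : (a ++ [(p, s)] ++ (s, r) :: b).length = k.1.length + k'.1.length := by
      rw [hlen, hlen', e1, e2]
      simp
      omega
    -- Besides `l, l'`, only the pair that concatenates to `z` could contribute, and the coefficient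
    -- of its first word in `m` is zero by `hms`. A rewritten pair is determined by `z`, as the side
    -- has just one base.
    rcases G.eq_or_exists_of_wordAct_apply_ne_zero hlz hne with h2 | h2
    · obtain ⟨e3, e4⟩ := List.append_inj h2 (by rw [hlen, e1]; simp)
      refine absurd ?_ hk
      rw [← hms]
      congr 1
      exact Subtype.ext e3.symm
    · obtain ⟨a', p', q', s', r', b', e3, e4, hq', hss, e5⟩ := h2
      replace e5 : (a ++ [(p, s)]) ++ ((s, r) :: b) = (a' ++ [(p', s')]) ++ ((s', r') :: b') := by
        simpa using e5
      obtain ⟨e6, e7⟩ := List.append_inj e5 (by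
        have : k.1.length = l.1.length := hlen
        rw [e1, e3] at this
        simpa using this.symm)
      simp only [List.append_singleton_inj, Prod.mk.injEq, List.cons.injEq] at e6 e7
      obtain ⟨rfl, rfl, rfl⟩ := e6
      obtain ⟨⟨-, rfl⟩, rfl⟩ := e7
      obtain rfl : q = q' := by
        have h3 : G.adj p q' := G.normal_singleton.1 (G.normal_append.1 (e3 ▸ k.2)).2.1
        rw [hq, hq']
        congr 1
        have h1 := G.side_ne hpq
        have h2 := G.side_ne h3
        revert h1 h2
        cases G.side p <;> cases G.side q <;> cases G.side q' <;> simp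
      exact ⟨Subtype.ext (e3.trans e1.symm), Subtype.ext (e4.trans e2.symm)⟩

end Domain

end PointedBipartite

/-! ### Weighted Leavitt path algebras and their universal property. -/

namespace WeightedGraph

variable (E : WeightedGraph.{u, v})

theorem mem_outEdges {v : E.Vertex} {α : E.StEdge} : α ∈ E.outEdges v ↔ E.source α = v := by
  simp [outEdges]

theorem weight_le_maxWeight (α : E.StEdge) : E.weight α ≤ E.maxWeight (E.source α) :=
  Finset.le_sup (f := E.weight) (E.mem_outEdges.2 rfl)

/-- A family of elements of a ring that satisfies the relations of the weighted Leavitt path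
algebra. -/
structure IsLeavittFamily {B : Type*} [NonUnitalRing B] (V : E.Vertex → B)
    (e g : E.StEdge → ℕ → B) : Prop where
  edge_eq_zero : ∀ α i, E.weight α ≤ i → e α i = 0
  ghost_eq_zero : ∀ α i, E.weight α ≤ i → g α i = 0
  vertex_mul_self : ∀ v, V v * V v = V v
  vertex_mul_of_ne : ∀ v w, v ≠ w → V v * V w = 0
  source_mul_edge : ∀ α i, i < E.weight α → V (E.source α) * e α i = e α i
  edge_mul_range : ∀ α i, i < E.weight α → e α i * V (E.range α) = e α i
  range_mul_ghost : ∀ α i, i < E.weight α → V (E.range α) * g α i = g α i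
  ghost_mul_source : ∀ α i, i < E.weight α → g α i * V (E.source α) = g α i
  edge_mul_ghost : ∀ v i, i < E.maxWeight v → ∑ α ∈ E.outEdges v, e α i * g α i = V v
  edge_mul_ghost_of_ne : ∀ v i j, i < E.maxWeight v → j < E.maxWeight v → i ≠ j →
    ∑ α ∈ E.outEdges v, e α i * g α j = 0
  ghost_mul_edge : ∀ α, ∑ i ∈ Finset.range (E.weight α), g α i * e α i = V (E.range α)
  ghost_mul_edge_of_ne : ∀ α β, α ≠ β →
    ∑ i ∈ Finset.range (max (E.weight α) (E.weight β)), g α i * e β i = 0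

variable {E} in
theorem IsLeavittFamily.map {B C : Type*} [NonUnitalRing B] [NonUnitalRing C] {V : E.Vertex → B}
    {e g : E.StEdge → ℕ → B} (h : E.IsLeavittFamily V e g) (f : B →ₙ+* C) :
    E.IsLeavittFamily (fun v => f (V v)) (fun α i => f (e α i)) fun α i => f (g α i) where
  edge_eq_zero α i hi := by simp [h.edge_eq_zero α i hi]
  ghost_eq_zero α i hi := by simp [h.ghost_eq_zero α i hi]
  vertex_mul_self v := by simp [← map_mul, h.vertex_mul_self]
  vertex_mul_of_ne v w hne := by simp [← map_mul, h.vertex_mul_of_ne v w hne]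
  source_mul_edge α i hi := by simp [← map_mul, h.source_mul_edge α i hi]
  edge_mul_range α i hi := by simp [← map_mul, h.edge_mul_range α i hi]
  range_mul_ghost α i hi := by simp [← map_mul, h.range_mul_ghost α i hi]
  ghost_mul_source α i hi := by simp [← map_mul, h.ghost_mul_source α i hi]
  edge_mul_ghost v i hi := by simp [← map_mul, ← map_sum, h.edge_mul_ghost v i hi]
  edge_mul_ghost_of_ne v i j hi hj hne := by
    simp [← map_mul, ← map_sum, h.edge_mul_ghost_of_ne v i j hi hj hne]
  ghost_mul_edge α := by simp [← map_mul, ← map_sum, h.ghost_mul_edge α]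
  ghost_mul_edge_of_ne α β hne := by
    simp [← map_mul, ← map_sum, h.ghost_mul_edge_of_ne α β hne]

section Quotient

variable (R : Type w) [Ring R]

theorem sub_mem_relIdeal {a b : FreeRRing R E.Gen} (h : E.Rel R a b) : a - b ∈ E.relIdeal R :=
  (TwoSidedIdeal.mem_sInf _).2 fun _ hI => hI.1 a b h

theorem smul_mem_relIdeal (r : R) {a : FreeRRing R E.Gen} (h : a ∈ E.relIdeal R) :
    r • a ∈ E.relIdeal R :=
  (TwoSidedIdeal.mem_sInf _).2 fun I hI => (hI.2 r a ((TwoSidedIdeal.mem_sInf _).1 h I hI)).1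

/-- The projection onto the weighted Leavitt path algebra. -/
noncomputable def proj : FreeRRing R E.Gen →ₙ+* E.LeavittPathAlgebra R where
  toFun a := (a : (E.relIdeal R).ringCon.Quotient)
  map_mul' _ _ := rfl
  map_zero' := rfl
  map_add' _ _ := rfl

theorem proj_surjective : Function.Surjective (E.proj R) := Quotient.mk''_surjective

theorem proj_eq_iff {a b : FreeRRing R E.Gen} :
    E.proj R a = E.proj R b ↔ a - b ∈ E.relIdeal R := by
  rw [← TwoSidedIdeal.rel_iff]
  exact (E.relIdeal R).ringCon.eq

noncomputable instance : SMul R (E.LeavittPathAlgebra R) where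
  smul r := Quotient.map' (fun a => r • a) fun a b h => by
    have h' := E.smul_mem_relIdeal R r (((E.relIdeal R).rel_iff a b).1 h)
    rw [smul_sub] at h'
    exact ((E.relIdeal R).rel_iff _ _).2 h'

theorem smul_proj (r : R) (a : FreeRRing R E.Gen) : r • E.proj R a = E.proj R (r • a) := rfl

noncomputable instance : Module R (E.LeavittPathAlgebra R) :=
  Function.Surjective.module R (AddMonoidHomClass.toAddMonoidHom (E.proj R))
    (E.proj_surjective R) fun r a => (E.smul_proj R r a).symm

instance : IsScalarTower R (E.LeavittPathAlgebra R) (E.LeavittPathAlgebra R) where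
  smul_assoc r a b := by
    obtain ⟨a, rfl⟩ := E.proj_surjective R a
    obtain ⟨b, rfl⟩ := E.proj_surjective R b
    rw [smul_proj, smul_eq_mul, smul_eq_mul, ← map_mul, ← map_mul, smul_proj, smul_mul_assoc]

theorem gen_mul_smul (x : E.Gen) (r : R) (a : FreeRRing R E.Gen) :
    E.gen R x * r • a = r • (E.gen R x * a) := by
  induction a using MonoidAlgebra.induction_linear with
  | zero => simp
  | add a b ha hb => rw [smul_add, mul_add, mul_add, smul_add, ha, hb]
  | single m s => simp [gen, MonoidAlgebra.single_mul_single]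

theorem proj_gen_mul_smul (x : E.Gen) (r : R) (a : E.LeavittPathAlgebra R) :
    E.proj R (E.gen R x) * r • a = r • (E.proj R (E.gen R x) * a) := by
  obtain ⟨a, rfl⟩ := E.proj_surjective R a
  rw [smul_proj, ← map_mul, ← map_mul, smul_proj, gen_mul_smul]

/-- A submodule of the weighted Leavitt path algebra that contains the generators and is closed
under left multiplication by them is everything. -/
theorem submodule_eq_top (S : Submodule R (E.LeavittPathAlgebra R))
    (h1 : ∀ x, E.proj R (E.gen R x) ∈ S)
    (h2 : ∀ x, ∀ a ∈ S, E.proj R (E.gen R x) * a ∈ S) : S = ⊤ := by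
  refine Submodule.eq_top_iff'.2 fun a => ?_
  obtain ⟨a, rfl⟩ := E.proj_surjective R a
  induction a using MonoidAlgebra.induction_linear with
  | zero => rw [map_zero]; exact zero_mem S
  | add a b ha hb => rw [map_add]; exact add_mem ha hb
  | single m r =>
    have hm : E.proj R (MonoidAlgebra.single m 1) ∈ S := by
      induction m using FreeSemigroup.recOnMul with
      | ih1 x => exact h1 x
      | ih2 x y _ hy =>
        have := h2 x _ hy
        rwa [← map_mul, gen, MonoidAlgebra.single_mul_single, mul_one] at this
    have := S.smul_mem r hm
    rwa [smul_proj, MonoidAlgebra.smul_single, smul_eq_mul, mul_one] at this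

/-- The generators of the weighted Leavitt path algebra satisfy its relations. -/
theorem isLeavittFamily_proj : E.IsLeavittFamily (fun v => E.proj R (E.vtx R v))
    (fun α i => E.proj R (E.edg R α i)) fun α i => E.proj R (E.gst R α i) := by
  have key : ∀ {a b}, E.Rel R a b → E.proj R a = E.proj R b := fun h =>
    (E.proj_eq_iff R).2 (E.sub_mem_relIdeal R h)
  refine ⟨fun α i hi => ?_, fun α i hi => ?_, fun v => ?_, fun v w hne => ?_, fun α i hi => ?_,
    fun α i hi => ?_, fun α i hi => ?_, fun α i hi => ?_, fun v i hi => ?_,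
    fun v i j hi hj hne => ?_, fun α => ?_, fun α β hne => ?_⟩
  · rw [edg, dif_neg (not_lt.2 hi), map_zero]
  · rw [gst, dif_neg (not_lt.2 hi), map_zero]
  · simpa [← map_mul] using key (.vertex_mul_vertex v v)
  · simpa [← map_mul, hne] using key (.vertex_mul_vertex v w)
  · simpa [← map_mul] using key (.source_mul_edge α i hi)
  · simpa [← map_mul] using key (.edge_mul_range α i hi)
  · simpa [← map_mul] using key (.range_mul_ghost α i hi)
  · simpa [← map_mul] using key (.ghost_mul_source α i hi)
  · simpa [← map_mul, ← map_sum] using key (.edge_mul_ghost v i i hi hi)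
  · simpa [← map_mul, ← map_sum, hne] using key (.edge_mul_ghost v i j hi hj)
  · simpa [← map_mul, ← map_sum] using key (.ghost_mul_edge α α)
  · simpa [← map_mul, ← map_sum, hne] using key (.ghost_mul_edge α β)

variable {R E} in
/-- The universal property of the weighted Leavitt path algebra. -/
theorem IsLeavittFamily.exists_lift {B : Type*} [Ring B] {V : E.Vertex → B}
    {e g : E.StEdge → ℕ → B} (h : E.IsLeavittFamily V e g) (c : R →+* B)
    (hV : ∀ r v, Commute (c r) (V v)) (he : ∀ r α i, Commute (c r) (e α i))
    (hg : ∀ r α i, Commute (c r) (g α i)) :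
    ∃ φ : E.LeavittPathAlgebra R →ₙ+* B,
      (∀ (r : R) (a : E.LeavittPathAlgebra R), φ (r • a) = c r * φ a) ∧
      (∀ v, φ (E.proj R (E.vtx R v)) = V v) ∧ (∀ α i, φ (E.proj R (E.edg R α i)) = e α i) ∧
      ∀ α i, φ (E.proj R (E.gst R α i)) = g α i := by
  let G : E.Gen → B := fun x => match x with
    | .vertex v => V v
    | .edge α i => e α i
    | .ghost α i => g α i
  have hG : ∀ r x, Commute (c r) (G x) := by
    rintro r (v | ⟨α, i⟩ | ⟨α, i⟩)
    exacts [hV r v, he r α i, hg r α i]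
  have hcomm : ∀ r (m : FreeSemigroup E.Gen), Commute (c r) (FreeSemigroup.lift G m) := by
    intro r m
    induction m using FreeSemigroup.recOnMul with
    | ih1 x => simpa using hG r x
    | ih2 x y _ hy => rw [map_mul]; exact (by simpa using hG r x : Commute _ _).mul_right hy
  let θ : FreeRRing R E.Gen →ₙ+* B :=
    { MonoidAlgebra.liftNC (c : R →+ B) (FreeSemigroup.lift G) with
      map_mul' := fun a b => MonoidAlgebra.liftNC_mul c (FreeSemigroup.lift G) a b
        fun {_ _} _ => hcomm _ _ }
  have hsingle : ∀ m r, θ (MonoidAlgebra.single m r) = c r * FreeSemigroup.lift G m :=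
    fun m r => MonoidAlgebra.liftNC_single _ _ _ _
  have hgen : ∀ x, θ (E.gen R x) = G x := by
    intro x
    rw [gen, hsingle]
    simp
  have hvtx : ∀ v, θ (E.vtx R v) = V v := fun v => hgen _
  have hedg : ∀ α i, θ (E.edg R α i) = e α i := by
    intro α i
    by_cases hi : i < E.weight α
    · rw [edg, dif_pos hi]
      exact hgen _
    · rw [edg, dif_neg hi, map_zero, h.edge_eq_zero α i (not_lt.1 hi)]
  have hgst : ∀ α i, θ (E.gst R α i) = g α i := by
    intro α i
    by_cases hi : i < E.weight α
    · rw [gst, dif_pos hi]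
      exact hgen _
    · rw [gst, dif_neg hi, map_zero, h.ghost_eq_zero α i (not_lt.1 hi)]
  have hsmul : ∀ r a, θ (r • a) = c r * θ a := by
    intro r a
    induction a using MonoidAlgebra.induction_linear with
    | zero => simp
    | add a b ha hb => rw [smul_add, map_add, ha, hb, map_add, mul_add]
    | single m s => rw [MonoidAlgebra.smul_single, hsingle, hsingle, smul_eq_mul, map_mul, mul_assoc]
  have hop : ∀ r a, θ (MulOpposite.op r • a) = θ a * c r := by
    intro r a
    induction a using MonoidAlgebra.induction_linear with
    | zero => simp
    | add a b ha hb => rw [smul_add, map_add, ha, hb, map_add, add_mul]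
    | single m s =>
      rw [MonoidAlgebra.smul_single, hsingle, hsingle, op_smul_eq_mul, map_mul,
        mul_assoc, mul_assoc, (hcomm r m).eq]
  have hrel : ∀ a b, E.Rel R a b → θ a = θ b := by
    classical
    intro a b hab
    cases hab with
    | vertex_mul_vertex v w =>
      split_ifs with hvw
      · subst hvw
        rw [map_mul, hvtx, h.vertex_mul_self]
      · rw [map_mul, hvtx, hvtx, h.vertex_mul_of_ne v w hvw, map_zero]
    | source_mul_edge α i hi => rw [map_mul, hvtx, hedg, h.source_mul_edge α i hi]
    | edge_mul_range α i hi => rw [map_mul, hvtx, hedg, h.edge_mul_range α i hi]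
    | range_mul_ghost α i hi => rw [map_mul, hvtx, hgst, h.range_mul_ghost α i hi]
    | ghost_mul_source α i hi => rw [map_mul, hvtx, hgst, h.ghost_mul_source α i hi]
    | edge_mul_ghost v i j hi hj =>
      simp only [map_sum, map_mul, hedg, hgst]
      split_ifs with hij
      · subst hij
        rw [h.edge_mul_ghost v i hi, hvtx]
      · rw [h.edge_mul_ghost_of_ne v i j hi hj hij, map_zero]
    | ghost_mul_edge α β =>
      simp only [map_sum, map_mul, hedg, hgst]
      split_ifs with hαβ
      · subst hαβ
        rw [max_self, h.ghost_mul_edge, hvtx]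
      · rw [h.ghost_mul_edge_of_ne α β hαβ, map_zero]
  -- The kernel of `θ` belongs to the family whose infimum is `relIdeal`; it is stable under scalars
  -- on both sides by `hsmul` and `hop`.
  have hker : ∀ a ∈ E.relIdeal R, θ a = 0 := by
    intro a ha
    rw [← TwoSidedIdeal.mem_ker]
    refine (TwoSidedIdeal.mem_sInf _).1 ha (TwoSidedIdeal.ker θ) ⟨fun a b hab => ?_, fun r a ha => ?_⟩
    · rw [TwoSidedIdeal.mem_ker, map_sub, hrel a b hab, sub_self]
    · rw [TwoSidedIdeal.mem_ker] at ha
      rw [TwoSidedIdeal.mem_ker, TwoSidedIdeal.mem_ker, hsmul, hop, ha]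
      simp
  have hwd : ∀ a b, (E.relIdeal R).ringCon.toSetoid a b → θ a = θ b := by
    intro a b hab
    rw [← sub_eq_zero, ← map_sub]
    exact hker _ (((E.relIdeal R).rel_iff a b).1 hab)
  let φ : E.LeavittPathAlgebra R →ₙ+* B :=
    { toFun := Quotient.lift θ hwd
      map_mul' := by
        intro a b
        obtain ⟨a, rfl⟩ := E.proj_surjective R a
        obtain ⟨b, rfl⟩ := E.proj_surjective R b
        exact map_mul θ a b
      map_zero' := map_zero θ
      map_add' := by
        intro a b
        obtain ⟨a, rfl⟩ := E.proj_surjective R a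
        obtain ⟨b, rfl⟩ := E.proj_surjective R b
        exact map_add θ a b }
  refine ⟨φ, fun r a => ?_, hvtx, hedg, hgst⟩
  obtain ⟨a, rfl⟩ := E.proj_surjective R a
  exact hsmul r a

variable {R E} in
/-- Linear operators that satisfy the relations define an action of the weighted Leavitt path
algebra. -/
theorem IsLeavittFamily.exists_action {M : Type*} [AddCommGroup M] [Module R M]
    {V : E.Vertex → Module.End R M} {e g : E.StEdge → ℕ → Module.End R M}
    (h : E.IsLeavittFamily V e g) :
    ∃ φ : E.LeavittPathAlgebra R →ₙ+* AddMonoid.End M,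
      (∀ (r : R) (a : E.LeavittPathAlgebra R) m, φ (r • a) m = r • φ a m) ∧
      (∀ v m, φ (E.proj R (E.vtx R v)) m = V v m) ∧
      (∀ α i m, φ (E.proj R (E.edg R α i)) m = e α i m) ∧
      ∀ α i m, φ (E.proj R (E.gst R α i)) m = g α i m := by
  -- Over a noncommutative `R` scalar multiplications need not be `R`-linear, so everything is moved
  -- to additive endomorphisms, where linear operators commute with scalars.
  let J := Module.toAddMonoidEnd (Module.End R M) M
  have hJ : ∀ r f, Commute (Module.toAddMonoidEnd R M r) (J f) := by
    intro r f
    ext m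
    exact (map_smul f r m).symm
  obtain ⟨φ, h1, h2, h3, h4⟩ := (h.map (J : _ →ₙ+* _)).exists_lift (Module.toAddMonoidEnd R M)
    (fun r v => hJ r _) (fun r α i => hJ r _) fun r α i => hJ r _
  refine ⟨φ, fun r a m => ?_, fun v m => ?_, fun α i m => ?_, fun α i m => ?_⟩
  · rw [h1]; rfl
  · rw [h2]; rfl
  · rw [h3]; rfl
  · rw [h4]; rfl

end Quotient

end WeightedGraph

/-! ### The domain criterion for algebras given by two mutually inverse matrices. -/

namespace PointedBipartite

section Domain

variable {K : Type*} (G : PointedBipartite K) [Fintype K] {R : Type w} [Ring R]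

open Classical in
theorem sum_act_mul_act {p p' : K} (h : G.side p = G.side p') :
    (∑ q ∈ G.opp p, G.act R p q * G.act R q p' : Module.End R _) = if p = p' then 1 else 0 := by
  refine LinearMap.ext fun m => ?_
  rw [LinearMap.sum_apply]
  refine (IsRep.sum_eq_ite G G.isRep_act h m).trans ?_
  split_ifs <;> rfl

/-- A ring that is generated by a vertex and arrows subject to the Leavitt relations and that acts
on the free module on the normal sequences is a domain. -/
theorem isRingDomain_of_action [IsDomain R] (hG : G.HasSecondBase) {A : Type*} [NonUnitalRing A]
    [Module R A] [IsScalarTower R A A] (y : K → K → A) (e : A) (he : ∀ a, e * a = a)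
    (hcomm : ∀ p q (r : R) a, y p q * r • a = r • (y p q * a))
    (hzero : ∀ p q, ¬ G.adj p q → y p q = 0)
    (hsum : ∀ p, ∑ q ∈ G.opp p, y p q * y q p = e)
    (hsum' : ∀ p p', G.side p = G.side p' → p ≠ p' → ∑ q ∈ G.opp p, y p q * y q p' = 0)
    (hgen : ∀ S : Submodule R A, e ∈ S → (∀ p q, ∀ a ∈ S, y p q * a ∈ S) → S = ⊤)
    (ρ : A →ₙ+* AddMonoid.End (G.Model R)) (hsmul : ∀ (r : R) (a : A) m, ρ (r • a) m = r • ρ a m)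
    (hρe : ∀ m, ρ e m = m) (hρ : ∀ p q m, ρ (y p q) m = G.act R p q m) : IsRingDomain A := by
  let Y : K → K → A →ₗ[R] A := fun p q =>
    { toFun := fun a => y p q * a
      map_add' := mul_add _
      map_smul' := hcomm p q }
  have hY : G.IsRep Y := by
    refine ⟨fun {p q} h => ?_, ?_, fun {p p'} hs hne a => ?_⟩
    · ext a
      change y p q * a = 0
      rw [hzero p q h, zero_mul]
    · rintro p _ hs rfl a
      change ∑ q ∈ G.opp p, y p q * (y q p * a) = a
      simp_rw [← mul_assoc]
      rw [← Finset.sum_mul, hsum, he]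
    · change ∑ q ∈ G.opp p, y p q * (y q p' * a) = 0
      simp_rw [← mul_assoc]
      rw [← Finset.sum_mul, hsum' p p' hs hne, zero_mul]
  have hadd : ∀ a b m, ρ (a + b) m = ρ a m + ρ b m := fun a b m => by rw [map_add]; rfl
  -- The map `a ↦ ρ a []` is injective with left inverse `G.orbit Y e`, and `a` acts as
  -- multiplication by its image. Both hold for `e` and persist under left multiplication by arrows.
  have key : ∀ a : A, G.orbit Y e (ρ a (G.nf R [])) = a ∧
      ∀ n, ρ a n = G.orbit (G.act R) n (ρ a (G.nf R [])) := by
    let S : Submodule R A :=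
      { carrier := {a | G.orbit Y e (ρ a (G.nf R [])) = a ∧
          ∀ n, ρ a n = G.orbit (G.act R) n (ρ a (G.nf R []))}
        add_mem' := by
          rintro a b ⟨ha, ha'⟩ ⟨hb, hb'⟩
          refine ⟨?_, fun n => ?_⟩
          · rw [hadd, map_add, ha, hb]
          · rw [hadd, hadd, map_add, ← ha', ← hb']
        zero_mem' := by
          refine ⟨?_, fun n => ?_⟩ <;> simp
        smul_mem' := by
          rintro r a ⟨ha, ha'⟩
          refine ⟨?_, fun n => ?_⟩
          · rw [hsmul, map_smul, ha]
          · rw [hsmul, hsmul, map_smul, ← ha'] }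
    have hS : S = ⊤ := by
      refine hgen S ⟨?_, fun n => ?_⟩ ?_
      · rw [hρe, hY.orbit_nil]
      · rw [hρe, hρe, G.isRep_act.orbit_nil]
      · rintro p q a ⟨ha, ha'⟩
        refine ⟨?_, fun n => ?_⟩
        · rw [map_mul, AddMonoid.End.coe_mul, Function.comp_apply, hρ, hY.orbit_act, ha]
          rfl
        · rw [map_mul, AddMonoid.End.coe_mul, Function.comp_apply, Function.comp_apply, hρ, hρ,
            G.isRep_act.orbit_act, ← ha']
    exact fun a => (hS ▸ Submodule.mem_top : a ∈ S)
  refine ⟨⟨e, 0, fun h => ?_⟩, fun a b hab => ?_⟩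
  · have h1 := hρe (G.nf R [])
    rw [h, map_zero, nf_of_normal G G.normal_nil] at h1
    exact one_ne_zero (Finsupp.single_eq_zero.1 h1.symm)
  · by_contra! hne
    have h1 : ∀ c, c ≠ 0 → ρ c (G.nf R []) ≠ 0 := fun c hc h0 =>
      hc (by rw [← (key c).1, h0, map_zero])
    refine G.orbit_act_ne_zero hG (h1 a hne.1) (h1 b hne.2) ?_
    rw [← (key a).2]
    have : ρ (a * b) (G.nf R []) = 0 := by rw [hab, map_zero]; rfl
    rwa [map_mul] at this

end Domain

section Weights

variable {P : Type*} {N : ℕ}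

/-- The bipartite graph with vertices the indices `0, …, N - 1` and the elements of `P`, in which
the element `α` is adjacent to its first `wt α` indices. -/
def ofWeights (wt : P → ℕ) (hN : 0 < N) (α₀ : P) (hα₀ : N ≤ wt α₀) (hwt : ∀ α, 0 < wt α) :
    PointedBipartite (Fin N ⊕ P) where
  side p := p.isRight
  adj
    | .inl i, .inr α => i.1 < wt α
    | .inr α, .inl i => i.1 < wt α
    | _, _ => False
  base b := cond b (.inr α₀) (.inl ⟨0, hN⟩)
  adj_symm := by rintro (i | α) (j | β) <;> exact id
  side_ne := by rintro (i | α) (j | β) <;> simp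
  side_base := by rintro (_ | _) <;> rfl
  adj_base := by
    rintro (i | α) (_ | _) <;> simp [hwt]
    exact i.2.trans_le hα₀

variable (wt : P → ℕ) (hN : 0 < N) (α₀ : P) (hα₀ : N ≤ wt α₀) (hwt : ∀ α, 0 < wt α)

/-- The index `1` lies below every weight, and `α₁` reaches every index. This is where the LV
condition enters. -/
theorem hasSecondBase_ofWeights (hN' : 2 ≤ N) (hwt' : ∀ α, 2 ≤ wt α) (α₁ : P) (hne : α₁ ≠ α₀)
    (hα₁ : N ≤ wt α₁) : (ofWeights wt hN α₀ hα₀ hwt).HasSecondBase := by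
  rintro (_ | _)
  · refine ⟨.inl ⟨1, hN'⟩, rfl, by simp [ofWeights], ?_⟩
    rintro (i | α) hp
    · exact absurd rfl hp
    · exact hwt' α
  · refine ⟨.inr α₁, rfl, by simpa [ofWeights] using hne, ?_⟩
    rintro (i | α) hp
    · exact i.2.trans_le hα₁
    · exact absurd rfl hp

variable [Fintype P] {A : Type*} [AddCommMonoid A]

theorem sum_opp_inl (i : Fin N) (f : Fin N ⊕ P → A) :
    ∑ q ∈ (ofWeights wt hN α₀ hα₀ hwt).opp (.inl i), f q = ∑ α, f (.inr α) := by
  simp [opp, Finset.sum_filter, ofWeights]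

theorem sum_opp_inr (α : P) (f : Fin N ⊕ P → A) :
    ∑ q ∈ (ofWeights wt hN α₀ hα₀ hwt).opp (.inr α), f q = ∑ i, f (.inl i) := by
  simp [opp, Finset.sum_filter, ofWeights]

/-- The family of arrows with given values on the arrows from indices and to indices. -/
def arrows {A : Type*} [Zero A] (e : Fin N → P → A) (g : P → Fin N → A) :
    Fin N ⊕ P → Fin N ⊕ P → A
  | .inl i, .inr α => e i α
  | .inr α, .inl i => g α i
  | _, _ => 0

variable {R : Type w} [Ring R]

open Classical in
theorem sum_act_inl (i j : Fin N) :
    (∑ α, (ofWeights wt hN α₀ hα₀ hwt).act R (.inl i) (.inr α) *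
      (ofWeights wt hN α₀ hα₀ hwt).act R (.inr α) (.inl j) : Module.End R _) =
        if i = j then 1 else 0 := by
  have h := (ofWeights wt hN α₀ hα₀ hwt).sum_act_mul_act (R := R) (p := .inl i) (p' := .inl j) rfl
  rw [sum_opp_inl] at h
  simpa only [Sum.inl.injEq] using h

open Classical in
theorem sum_act_inr (α β : P) :
    (∑ i, (ofWeights wt hN α₀ hα₀ hwt).act R (.inr α) (.inl i) *
      (ofWeights wt hN α₀ hα₀ hwt).act R (.inl i) (.inr β) : Module.End R _) =
        if α = β then 1 else 0 := by
  have h := (ofWeights wt hN α₀ hα₀ hwt).sum_act_mul_act (R := R) (p := .inr α) (p' := .inr β) rfl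
  rw [sum_opp_inr] at h
  simpa only [Sum.inr.injEq] using h

/-- A ring that is generated by the entries of two mutually inverse matrices of finite size, with a
given pattern of zeros, and that acts on the free module on the normal sequences is a domain. -/
theorem isRingDomain_ofWeights [IsDomain R] (hN' : 2 ≤ N) (hwt' : ∀ α, 2 ≤ wt α) (α₁ : P)
    (hne : α₁ ≠ α₀) (hα₁ : N ≤ wt α₁) {A : Type*} [NonUnitalRing A] [Module R A]
    [IsScalarTower R A A] (e : Fin N → P → A) (g : P → Fin N → A) (o : A) (ho : ∀ a, o * a = a)
    (he : ∀ i α (r : R) a, e i α * r • a = r • (e i α * a))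
    (hg : ∀ i α (r : R) a, g α i * r • a = r • (g α i * a))
    (he0 : ∀ i α, wt α ≤ i.1 → e i α = 0) (hg0 : ∀ i α, wt α ≤ i.1 → g α i = 0)
    (heg : ∀ i, ∑ α, e i α * g α i = o) (heg' : ∀ i j, i ≠ j → ∑ α, e i α * g α j = 0)
    (hge : ∀ α, ∑ i, g α i * e i α = o) (hge' : ∀ α β, α ≠ β → ∑ i, g α i * e i β = 0)
    (hgen : ∀ S : Submodule R A, o ∈ S → (∀ i α, ∀ a ∈ S, e i α * a ∈ S) →
      (∀ i α, ∀ a ∈ S, g α i * a ∈ S) → S = ⊤)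
    (ρ : A →ₙ+* AddMonoid.End ((ofWeights wt hN α₀ hα₀ hwt).Model R))
    (hsmul : ∀ (r : R) (a : A) m, ρ (r • a) m = r • ρ a m) (hρo : ∀ m, ρ o m = m)
    (hρe : ∀ i α m, ρ (e i α) m = (ofWeights wt hN α₀ hα₀ hwt).act R (.inl i) (.inr α) m)
    (hρg : ∀ i α m, ρ (g α i) m = (ofWeights wt hN α₀ hα₀ hwt).act R (.inr α) (.inl i) m) :
    IsRingDomain A := by
  refine isRingDomain_of_action _ (hasSecondBase_ofWeights wt hN α₀ hα₀ hwt hN' hwt' α₁ hne hα₁)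
    (arrows e g) o ho ?_ ?_ ?_ ?_ ?_ ρ hsmul hρo ?_
  · rintro (i | α) (j | β) r a
    exacts [by simp [arrows], he i β r a, hg j α r a, by simp [arrows]]
  · rintro (i | α) (j | β) h
    exacts [rfl, he0 i β (not_lt.1 h), hg0 j α (not_lt.1 h), rfl]
  · rintro (i | α)
    · rw [sum_opp_inl]
      exact heg i
    · rw [sum_opp_inr]
      exact hge α
  · rintro (i | α) (j | β) hs hne
    · rw [sum_opp_inl]
      exact heg' i j fun h => hne (h ▸ rfl)
    · simp [ofWeights] at hs
    · simp [ofWeights] at hs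
    · rw [sum_opp_inr]
      exact hge' α β fun h => hne (h ▸ rfl)
  · exact fun S h1 h2 => hgen S h1 (fun i α => h2 (.inl i) (.inr α)) fun i α =>
      h2 (.inr α) (.inl i)
  · rintro (i | α) (j | β) m
    · rw [act_eq_zero _ (by exact id), show arrows e g (.inl i) (.inl j) = 0 from rfl, map_zero]
      rfl
    · exact hρe i β m
    · exact hρg j α m
    · rw [act_eq_zero _ (by exact id), show arrows e g (.inr α) (.inr β) = 0 from rfl, map_zero]
      rfl

end Weights

end PointedBipartite

/-! ### The Leavitt algebras. -/

namespace LeavittAlgebra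

open PointedBipartite

variable (R : Type w) [Ring R]

/-- The Leavitt algebra as a left module. -/
noncomputable abbrev module (n m : ℕ) : Module R (LeavittAlgebra R n m) :=
  Module.compHom _ ((RingQuot.mkRingHom (Rel R n m)).comp MonoidAlgebra.singleOneRingHom)

/-- With all weights equal to `n` the bipartite graph is complete, so `0` and `1` serve as base and
second base on both sides; hence the bounds on `n` and `m`. -/
theorem isRingDomain [IsDomain R] {n m : ℕ} (hn : 2 ≤ n) (hm : 2 ≤ m) :
    IsRingDomain (LeavittAlgebra R n m) := by
  classical
  let mk := RingQuot.mkRingHom (Rel R n m)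
  let _ : Module R (LeavittAlgebra R n m) := module R n m
  have smul_def : ∀ (r : R) (a : LeavittAlgebra R n m),
      r • a = mk (MonoidAlgebra.single 1 r) * a := fun _ _ => rfl
  have : IsScalarTower R (LeavittAlgebra R n m) (LeavittAlgebra R n m) :=
    ⟨fun r a b => by simp only [smul_def, smul_eq_mul, mul_assoc]⟩
  have hcomm : ∀ x (r : R) (a : LeavittAlgebra R n m),
      mk (MonoidAlgebra.single (FreeMonoid.of x) 1) * r • a =
        r • (mk (MonoidAlgebra.single (FreeMonoid.of x) 1) * a) := by
    intro x r a
    rw [smul_def, smul_def, ← mul_assoc, ← mul_assoc, ← map_mul, ← map_mul,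
      MonoidAlgebra.single_mul_single, MonoidAlgebra.single_mul_single]
    simp
  have hN : 0 < n := by omega
  let α₀ : Fin m := ⟨0, by omega⟩
  let α₁ : Fin m := ⟨1, hm⟩
  have hne : α₁ ≠ α₀ := by simp [α₀, α₁]
  let G : PointedBipartite (Fin n ⊕ Fin m) := ofWeights (fun _ => n) hN α₀ le_rfl fun _ => hN
  let J := Module.toAddMonoidEnd (Module.End R (G.Model R)) (G.Model R)
  let f : LeavittGen n m → AddMonoid.End (G.Model R)
    | .y i j => J (G.act R (.inl i) (.inr j))
    | .x j i => J (G.act R (.inr j) (.inl i))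
  have hf : ∀ r x, Commute (Module.toAddMonoidEnd R (G.Model R) r) (f x) := by
    intro r x
    cases x <;> exact AddMonoidHom.ext fun k => (map_smul (G.act R _ _) r k).symm
  have hf' : ∀ r x, Commute (Module.toAddMonoidEnd R (G.Model R) r) (FreeMonoid.lift f x) := by
    intro r x
    induction x using FreeMonoid.inductionOn' with
    | one => rw [map_one]; exact Commute.one_right _
    | of_mul x l ih =>
      rw [map_mul, FreeMonoid.lift_eval_of]
      exact (hf r x).mul_right ih
  let θ : Free R n m →+* AddMonoid.End (G.Model R) :=
    MonoidAlgebra.liftNCRingHom (Module.toAddMonoidEnd R (G.Model R)) (FreeMonoid.lift f) hf'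
  have hθ : ∀ x, θ (MonoidAlgebra.single (FreeMonoid.of x) 1) = f x := by
    intro x
    simp [θ, MonoidAlgebra.liftNCRingHom_single]
  have hrel : ∀ ⦃a b⦄, Rel R n m a b → θ a = θ b := by
    intro a b hab
    cases hab with
    | matY_mul_matX i j =>
      have h1 := congrArg J (sum_act_inl (R := R) (fun _ => n) hN α₀ le_rfl (fun _ => hN) i j)
      simp only [Matrix.mul_apply, map_sum, map_mul, matY, matX, hθ, Matrix.one_apply,
        apply_ite θ, apply_ite J, map_one, map_zero] at h1 ⊢
      exact h1
    | matX_mul_matY i j =>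
      have h1 := congrArg J (sum_act_inr (R := R) (fun _ => n) hN α₀ le_rfl (fun _ => hN) i j)
      simp only [Matrix.mul_apply, map_sum, map_mul, matY, matX, hθ, Matrix.one_apply,
        apply_ite θ, apply_ite J, map_one, map_zero] at h1 ⊢
      exact h1
  let ρ : LeavittAlgebra R n m →+* AddMonoid.End (G.Model R) := RingQuot.lift ⟨θ, hrel⟩
  have hρ : ∀ a, ρ (mk a) = θ a := fun a => RingQuot.lift_mkRingHom_apply θ hrel a
  have hYX : ∀ i j, ∑ k, mk (matY R n m i k) * mk (matX R n m k j) = if i = j then 1 else 0 := by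
    intro i j
    have h := RingQuot.mkRingHom_rel (Rel.matY_mul_matX (R := R) (n := n) (m := m) i j)
    rw [Matrix.mul_apply, map_sum, Matrix.one_apply, apply_ite (RingQuot.mkRingHom _), map_one,
      map_zero] at h
    rw [← h]
    exact Finset.sum_congr rfl fun k _ => (map_mul mk _ _).symm
  have hXY : ∀ i j, ∑ k, mk (matX R n m i k) * mk (matY R n m k j) = if i = j then 1 else 0 := by
    intro i j
    have h := RingQuot.mkRingHom_rel (Rel.matX_mul_matY (R := R) (n := n) (m := m) i j)
    rw [Matrix.mul_apply, map_sum, Matrix.one_apply, apply_ite (RingQuot.mkRingHom _), map_one,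
      map_zero] at h
    rw [← h]
    exact Finset.sum_congr rfl fun k _ => (map_mul mk _ _).symm
  refine isRingDomain_ofWeights (R := R) (fun _ => n) hN α₀ le_rfl (fun _ => hN) hn (fun _ => hn) α₁ hne
    le_rfl (fun i j => mk (matY R n m i j)) (fun j i => mk (matX R n m j i)) 1 one_mul
    (fun i j => hcomm _) (fun i j => hcomm _) (fun i _ h => absurd i.2 (not_lt.2 h))
    (fun i _ h => absurd i.2 (not_lt.2 h)) (fun i => (hYX i i).trans (if_pos rfl))
    (fun i j h => (hYX i j).trans (if_neg h)) (fun i => (hXY i i).trans (if_pos rfl))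
    (fun i j h => (hXY i j).trans (if_neg h)) ?_ (ρ : _ →ₙ+* _) ?_ ?_ ?_ ?_
  · intro S h1 hY hX
    refine Submodule.eq_top_iff'.2 fun a => ?_
    obtain ⟨a, rfl⟩ := RingQuot.mkRingHom_surjective (Rel R n m) a
    induction a using MonoidAlgebra.induction_linear with
    | zero => rw [map_zero]; exact zero_mem S
    | add a b ha hb => rw [map_add]; exact add_mem ha hb
    | single l r =>
      have hl : mk (MonoidAlgebra.single l 1) ∈ S := by
        induction l using FreeMonoid.inductionOn' with
        | one => exact (map_one mk).symm ▸ h1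
        | of_mul x l ih =>
          have hx : mk (MonoidAlgebra.single (FreeMonoid.of x) 1) *
              mk (MonoidAlgebra.single l 1) ∈ S := by
            cases x with
            | y i j => exact hY i j _ ih
            | x j i => exact hX i j _ ih
          rwa [← map_mul, MonoidAlgebra.single_mul_single, mul_one] at hx
      have := S.smul_mem r hl
      rwa [smul_def, ← map_mul, MonoidAlgebra.single_mul_single, one_mul, mul_one] at this
  · intro r a k
    change ρ (r • a) k = r • ρ a k
    rw [smul_def, map_mul, hρ]
    simp only [θ, MonoidAlgebra.liftNCRingHom_single, map_one, mul_one]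
    rfl
  · exact fun k => congrArg (fun φ : AddMonoid.End (G.Model R) => φ k) (map_one ρ)
  · exact fun i j k => congrArg (fun φ : AddMonoid.End (G.Model R) => φ k) ((hρ _).trans (hθ _))
  · exact fun i j k => congrArg (fun φ : AddMonoid.End (G.Model R) => φ k) ((hρ _).trans (hθ _))

end LeavittAlgebra

/-! ### Sufficiency for roses. -/

namespace WeightedGraph

variable {E : WeightedGraph.{u, v}} (R : Type w) [Ring R]

section Rose

theorem sum_range_eq_sum_fin {A : Type*} [AddCommMonoid A] (f : ℕ → A) {k N : ℕ} (hk : k ≤ N)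
    (hf : ∀ i, k ≤ i → f i = 0) : ∑ i ∈ Finset.range k, f i = ∑ i : Fin N, f i := by
  rw [Fin.sum_univ_eq_sum_range]
  exact Finset.sum_subset (Finset.range_subset_range.2 hk) fun i _ hi => hf i (by simpa using hi)

theorem proj_gen_edge (α : E.StEdge) (i : Fin (E.weight α)) :
    E.proj R (E.gen R (.edge α i)) = E.proj R (E.edg R α i) := by
  rw [edg, dif_pos i.2]

theorem proj_gen_ghost (α : E.StEdge) (i : Fin (E.weight α)) :
    E.proj R (E.gen R (.ghost α i)) = E.proj R (E.gst R α i) := by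
  rw [gst, dif_pos i.2]

theorem edg_mul_smul (α : E.StEdge) (i : ℕ) (r : R) (a : E.LeavittPathAlgebra R) :
    E.proj R (E.edg R α i) * r • a = r • (E.proj R (E.edg R α i) * a) := by
  by_cases hi : i < E.weight α
  · rw [edg, dif_pos hi, proj_gen_mul_smul]
  · simp [edg, hi]

theorem gst_mul_smul (α : E.StEdge) (i : ℕ) (r : R) (a : E.LeavittPathAlgebra R) :
    E.proj R (E.gst R α i) * r • a = r • (E.proj R (E.gst R α i) * a) := by
  by_cases hi : i < E.weight α
  · rw [gst, dif_pos hi, proj_gen_mul_smul]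
  · simp [gst, hi]

variable [Subsingleton E.Vertex]

theorem vtx_mul (v : E.Vertex) (a : E.LeavittPathAlgebra R) : E.proj R (E.vtx R v) * a = a := by
  have h := E.isLeavittFamily_proj R
  let S : Submodule R (E.LeavittPathAlgebra R) :=
    { carrier := {a | E.proj R (E.vtx R v) * a = a}
      add_mem' := fun {a b} (ha : _ = a) (hb : _ = b) => by
        rw [Set.mem_ofPred_eq, mul_add, ha, hb]
      zero_mem' := mul_zero _
      smul_mem' := fun r a (ha : _ = a) => by
        rw [Set.mem_ofPred_eq, vtx, proj_gen_mul_smul, ← vtx, ha] }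
  have hx : ∀ x, E.proj R (E.vtx R v) * E.proj R (E.gen R x) = E.proj R (E.gen R x) := by
    rintro (w | ⟨α, i⟩ | ⟨α, i⟩)
    · rw [Subsingleton.elim w v]
      exact h.vertex_mul_self v
    · rw [proj_gen_edge, Subsingleton.elim v (E.source α)]
      exact h.source_mul_edge α i i.2
    · rw [proj_gen_ghost, Subsingleton.elim v (E.range α)]
      exact h.range_mul_ghost α i i.2
  have hS := E.submodule_eq_top R S hx fun x a _ => by
    change _ * (_ * a) = _
    rw [← mul_assoc, hx]
  exact (hS ▸ Submodule.mem_top : a ∈ S)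

/-- A submodule of the weighted Leavitt path algebra of a rose that contains the vertex and is
closed under left multiplication by edges and ghost edges is everything. -/
theorem submodule_eq_top_of_rose (v : E.Vertex) (S : Submodule R (E.LeavittPathAlgebra R))
    (hv : E.proj R (E.vtx R v) ∈ S) (he : ∀ α i, ∀ a ∈ S, E.proj R (E.edg R α i) * a ∈ S)
    (hg : ∀ α i, ∀ a ∈ S, E.proj R (E.gst R α i) * a ∈ S) : S = ⊤ := by
  have h := E.isLeavittFamily_proj R
  refine E.submodule_eq_top R S ?_ ?_
  · rintro (w | ⟨α, i⟩ | ⟨α, i⟩)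
    · rw [Subsingleton.elim w v]
      exact hv
    · rw [proj_gen_edge, ← h.edge_mul_range α i i.2, Subsingleton.elim (E.range α) v]
      exact he α i _ hv
    · rw [proj_gen_ghost, ← h.ghost_mul_source α i i.2, Subsingleton.elim (E.source α) v]
      exact hg α i _ hv
  · rintro (w | ⟨α, i⟩ | ⟨α, i⟩) a ha
    · rw [← vtx, vtx_mul]
      exact ha
    · rw [proj_gen_edge]
      exact he α i a ha
    · rw [proj_gen_ghost]
      exact hg α i a ha

theorem outEdges_eq_univ [Fintype E.StEdge] (v : E.Vertex) : E.outEdges v = Finset.univ := by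
  ext α
  simp [mem_outEdges, Subsingleton.elim (E.source α) v]

open PointedBipartite

/-- The weighted Leavitt path algebra of an LV-rose over a domain is a domain. -/
theorem isRingDomain_of_LVRose [IsDomain R] (v : E.Vertex) (h2 : ∀ α, 2 ≤ E.weight α)
    (α₀ α₁ : E.StEdge) (hne : α₁ ≠ α₀) (h0 : E.weight α₀ = E.maxWeight v)
    (h1 : E.weight α₁ = E.maxWeight v) : IsRingDomain (E.LeavittPathAlgebra R) := by
  classical
  have : Finite E.StEdge := by
    refine Set.finite_univ_iff.1 ((E.rowFinite v).subset fun α _ => Subsingleton.elim _ _)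
  have : Fintype E.StEdge := Fintype.ofFinite _
  have hsub : ∀ w, w = v := fun w => Subsingleton.elim w v
  have hle : ∀ α, E.weight α ≤ E.maxWeight v := fun α => hsub (E.source α) ▸ E.weight_le_maxWeight α
  have hout : ∀ w, E.outEdges w = Finset.univ := fun w => outEdges_eq_univ w
  have hN2 : 2 ≤ E.maxWeight v := h0 ▸ h2 α₀
  generalize hNdef : E.maxWeight v = N at *
  have hmax : ∀ w, E.maxWeight w = N := fun w => by rw [hsub w, hNdef]
  have hN : 0 < N := by omega
  let G : PointedBipartite (Fin N ⊕ E.StEdge) :=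
    ofWeights E.weight hN α₀ h0.ge E.weight_pos
  let e : E.StEdge → ℕ → Module.End R (G.Model R) := fun α i =>
    if h : i < N then G.act R (.inl ⟨i, h⟩) (.inr α) else 0
  let g : E.StEdge → ℕ → Module.End R (G.Model R) := fun α i =>
    if h : i < N then G.act R (.inr α) (.inl ⟨i, h⟩) else 0
  have he : ∀ α (i : Fin N), e α i = G.act R (.inl i) (.inr α) := fun α i => dif_pos i.2
  have hg : ∀ α (i : Fin N), g α i = G.act R (.inr α) (.inl i) := fun α i => dif_pos i.2
  have he0 : ∀ α i, E.weight α ≤ i → e α i = 0 := by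
    intro α i hi
    by_cases h : i < N
    · simp only [e, dif_pos h]
      exact G.act_eq_zero (not_lt.2 hi)
    · exact dif_neg h
  have hg0 : ∀ α i, E.weight α ≤ i → g α i = 0 := by
    intro α i hi
    by_cases h : i < N
    · simp only [g, dif_pos h]
      exact G.act_eq_zero (not_lt.2 hi)
    · exact dif_neg h
  have hfam : E.IsLeavittFamily (fun _ => 1) e g := by
    refine ⟨he0, hg0, fun _ => one_mul 1, fun v w h => absurd (Subsingleton.elim v w) h,
      fun α i _ => one_mul _, fun α i _ => mul_one _, fun α i _ => one_mul _,
      fun α i _ => mul_one _, fun w i hi => ?_, fun w i j hi hj hij => ?_, fun α => ?_,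
      fun α β hαβ => ?_⟩
    · rw [hmax] at hi
      have := sum_act_inl (R := R) E.weight hN α₀ h0.ge E.weight_pos ⟨i, hi⟩ ⟨i, hi⟩
      rw [if_pos rfl] at this
      rw [hout, ← this]
      exact Finset.sum_congr rfl fun α _ => by rw [he α ⟨i, hi⟩, hg α ⟨i, hi⟩]
    · rw [hmax] at hi hj
      have := sum_act_inl (R := R) E.weight hN α₀ h0.ge E.weight_pos ⟨i, hi⟩ ⟨j, hj⟩
      rw [if_neg (by simpa using hij)] at this
      rw [hout, ← this]
      exact Finset.sum_congr rfl fun α _ => by rw [he α ⟨i, hi⟩, hg α ⟨j, hj⟩]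
    · have := sum_act_inr (R := R) E.weight hN α₀ h0.ge E.weight_pos α α
      rw [if_pos rfl] at this
      rw [← this, sum_range_eq_sum_fin _ (hle α) fun i hi => by rw [hg0 α i hi, zero_mul]]
      exact Finset.sum_congr rfl fun i _ => by rw [he, hg]
    · have := sum_act_inr (R := R) E.weight hN α₀ h0.ge E.weight_pos α β
      rw [if_neg hαβ] at this
      rw [← this, sum_range_eq_sum_fin _ (max_le (hle α) (hle β)) fun i hi => by
        rw [hg0 α i (le_of_max_le_left hi), zero_mul]]
      exact Finset.sum_congr rfl fun i _ => by rw [he, hg]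
  obtain ⟨φ, hφ, hφv, hφe, hφg⟩ := hfam.exists_action
  have hL := E.isLeavittFamily_proj R
  refine isRingDomain_ofWeights (R := R) E.weight hN α₀ h0.ge E.weight_pos hN2 h2 α₁ hne h1.ge
    (fun i α => E.proj R (E.edg R α i)) (fun α i => E.proj R (E.gst R α i)) (E.proj R (E.vtx R v))
    (vtx_mul R v) (fun i α => edg_mul_smul R α i) (fun i α => gst_mul_smul R α i)
    (fun i α hi => hL.edge_eq_zero α i hi) (fun i α hi => hL.ghost_eq_zero α i hi)
    (fun i => ?_) (fun i j hij => ?_) (fun α => ?_) (fun α β hαβ => ?_)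
    (fun S hS hS' hS'' => submodule_eq_top_of_rose R v S hS (fun α i a ha => ?_)
      fun α i a ha => ?_) φ hφ (fun m => hφv v m) (fun i α m => ?_) fun i α m => ?_
  · rw [← hL.edge_mul_ghost v i (by rw [hNdef]; exact i.2), hout]
  · rw [← hL.edge_mul_ghost_of_ne v i j (by rw [hNdef]; exact i.2) (by rw [hNdef]; exact j.2)
      fun h => hij (Fin.ext h), hout]
  · rw [← hsub (E.range α)]
    refine Eq.trans ?_ (hL.ghost_mul_edge α)
    rw [sum_range_eq_sum_fin _ (hle α)]
    exact fun i hi => by rw [hL.ghost_eq_zero α i hi, zero_mul]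
  · refine Eq.trans ?_ (hL.ghost_mul_edge_of_ne α β hαβ)
    rw [sum_range_eq_sum_fin _ (max_le (hle α) (hle β))]
    exact fun i hi => by rw [hL.ghost_eq_zero α i (le_of_max_le_left hi), zero_mul]
  · by_cases hi : i < N
    · exact hS' ⟨i, hi⟩ α a ha
    · rw [hL.edge_eq_zero α i ((hle α).trans (not_lt.1 hi)), zero_mul]
      exact zero_mem S
  · by_cases hi : i < N
    · exact hS'' ⟨i, hi⟩ α a ha
    · rw [hL.ghost_eq_zero α i ((hle α).trans (not_lt.1 hi)), zero_mul]
      exact zero_mem S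
  · rw [hφe, he]
  · rw [hφg, hg]

/-- The powers of the petal of an unweighted rose with at most one petal. -/
theorem exists_powers (v : E.Vertex) (h1 : E.IsUnweighted) (hs : Subsingleton E.StEdge) :
    ∃ p : ℤ → E.LeavittPathAlgebra R, p 0 = E.proj R (E.vtx R v) ∧
      (∀ α n, E.proj R (E.edg R α 0) * p n = p (1 + n)) ∧
      ∀ α n, E.proj R (E.gst R α 0) * p n = p (-1 + n) := by
  rcases isEmpty_or_nonempty E.StEdge with h | ⟨⟨α⟩⟩
  -- Without petals only the value at `0` matters, so a constant sequence will do.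
  · exact ⟨fun _ => E.proj R (E.vtx R v), rfl, fun α => isEmptyElim α, fun α => isEmptyElim α⟩
  have hL := E.isLeavittFamily_proj R
  have hmax : 0 < E.maxWeight (E.source α) := (E.weight_pos α).trans_le (E.weight_le_maxWeight α)
  have hge := hL.ghost_mul_edge α
  rw [h1 α, Finset.sum_range_one] at hge
  have heg := hL.edge_mul_ghost (E.source α) 0 hmax
  rw [Finset.sum_eq_single_of_mem α (E.mem_outEdges.2 rfl)
    fun β _ hβ => absurd (Subsingleton.elim β α) hβ] at heg
  -- With a single petal of weight one, relations (3) and (4) make left multiplication by the edge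
  -- invertible, so its integer powers exist.
  let ε : Equiv.Perm (E.LeavittPathAlgebra R) :=
    { toFun := fun a => E.proj R (E.edg R α 0) * a
      invFun := fun a => E.proj R (E.gst R α 0) * a
      left_inv := fun a => (mul_assoc _ _ _).symm.trans (by rw [hge, vtx_mul])
      right_inv := fun a => (mul_assoc _ _ _).symm.trans (by rw [heg, vtx_mul]) }
  refine ⟨fun n => (ε ^ n) (E.proj R (E.vtx R v)), rfl, fun β n => ?_, fun β n => ?_⟩
  · rw [Subsingleton.elim β α]
    change ε ((ε ^ n) _) = (ε ^ (1 + n)) _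
    rw [zpow_add, zpow_one, Equiv.Perm.mul_apply]
  · rw [Subsingleton.elim β α]
    change ε⁻¹ ((ε ^ n) _) = (ε ^ (-1 + n)) _
    rw [zpow_add, zpow_neg_one, Equiv.Perm.mul_apply]

/-- The weighted Leavitt path algebra of an unweighted rose with at most one petal over a domain
is a domain. -/
theorem isRingDomain_of_subsingleton [IsDomain R] (v : E.Vertex) (h1 : E.IsUnweighted)
    (hs : Subsingleton E.StEdge) : IsRingDomain (E.LeavittPathAlgebra R) := by
  obtain ⟨p, hp0, hpe, hpg⟩ := exists_powers R v h1 hs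
  let T : ℤ → AddMonoidAlgebra R ℤ := fun n => AddMonoidAlgebra.single n 1
  have hT : ∀ m n, T m * T n = T (m + n) := fun m n => by
    simp only [T]
    rw [AddMonoidAlgebra.single_mul_single, one_mul]
  have hT0 : T 0 = 1 := rfl
  have hfam : E.IsLeavittFamily (fun _ => T 0) (fun _ i => if i = 0 then T 1 else 0)
      fun _ i => if i = 0 then T (-1) else 0 := by
    have hlt : ∀ w, E.maxWeight w ≤ 1 := fun w => Finset.sup_le fun α _ => (h1 α).le
    refine ⟨fun α i hi => ?_, fun α i hi => ?_, fun _ => hT 0 0,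
      fun v w h => absurd (Subsingleton.elim v w) h, fun α i _ => by rw [hT0, one_mul],
      fun α i _ => by rw [hT0, mul_one], fun α i _ => by rw [hT0, one_mul],
      fun α i _ => by rw [hT0, mul_one], fun w i hi => ?_, fun w i j hi hj hij => ?_, fun α => ?_,
      fun α β h => absurd (Subsingleton.elim α β) h⟩
    · rw [if_neg]
      have := E.weight_pos α
      omega
    · rw [if_neg]
      have := E.weight_pos α
      omega
    · obtain ⟨α, hα, -⟩ := Finset.lt_sup_iff.1 hi
      obtain rfl : i = 0 := by have := hlt w; omega
      rw [Finset.sum_eq_single_of_mem α hα fun β _ hβ => absurd (Subsingleton.elim β α) hβ]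
      simp [hT]
    · have := hlt w
      omega
    · simp [h1 α, hT]
  have hc : ∀ r n, Commute (AddMonoidAlgebra.singleZeroRingHom r) (T n) := by
    intro r n
    simp [Commute, SemiconjBy, T]
  have hc' : ∀ r (i : ℕ) n, Commute (AddMonoidAlgebra.singleZeroRingHom (R := R) r)
      (if i = 0 then T n else 0) := by
    intro r i n
    split_ifs
    exacts [hc r n, Commute.zero_right _]
  obtain ⟨φ, hφ, hφv, hφe, hφg⟩ := hfam.exists_lift AddMonoidAlgebra.singleZeroRingHom
    (fun r _ => hc r 0) (fun r _ i => hc' r i 1) (fun r _ i => hc' r i (-1))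
  -- A left inverse of `φ`. It makes `φ` an embedding into the Laurent polynomials, which have no
  -- zero divisors.
  let ψ : AddMonoidAlgebra R ℤ →ₗ[R] E.LeavittPathAlgebra R :=
    (Finsupp.linearCombination R p).comp (AddMonoidAlgebra.coeffLinearEquiv R).toLinearMap
  have hψ : ∀ n r, ψ (AddMonoidAlgebra.single n r) = r • p n := fun n r =>
    Finsupp.linearCombination_single R r n
  have hψmul : ∀ (x : E.LeavittPathAlgebra R) (d : ℤ) (_ : ∀ (r : R) a, x * r • a = r • (x * a))
      (_ : ∀ n, x * p n = p (d + n)) (m : AddMonoidAlgebra R ℤ), ψ (T d * m) = x * ψ m := by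
    intro x d hx hxp m
    induction m using AddMonoidAlgebra.induction_linear with
    | zero => simp
    | add a b ha hb => rw [mul_add, map_add, map_add, mul_add, ha, hb]
    | single n r =>
      simp only [T]
      rw [AddMonoidAlgebra.single_mul_single, hψ, hψ, hx, hxp, one_mul]
  let S : Submodule R (E.LeavittPathAlgebra R) :=
    { carrier := {a | ψ (φ a) = a}
      add_mem' := fun {a b} (ha : _ = a) (hb : _ = b) => by
        rw [Set.mem_ofPred_eq, map_add, map_add, ha, hb]
      zero_mem' := by simp
      smul_mem' := fun r a (ha : _ = a) => by
        have : ∀ m : AddMonoidAlgebra R ℤ, AddMonoidAlgebra.singleZeroRingHom r * m = r • m := by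
          intro m
          induction m using AddMonoidAlgebra.induction_linear with
          | zero => simp
          | add a b ha hb => rw [mul_add, smul_add, ha, hb]
          | single n s =>
            change AddMonoidAlgebra.single 0 r * _ = _
            rw [AddMonoidAlgebra.smul_single, smul_eq_mul, AddMonoidAlgebra.single_mul_single,
              zero_add]
        rw [Set.mem_ofPred_eq, hφ, this, map_smul, ha] }
  have hL := E.isLeavittFamily_proj R
  have hS : S = ⊤ := by
    refine submodule_eq_top_of_rose R v S ?_ ?_ ?_
    · change ψ (φ _) = _
      rw [hφv, hψ, one_smul, hp0]
    · intro α i a (ha : _ = a)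
      by_cases hi : i = 0
      · subst hi
        change ψ (φ _) = _
        rw [map_mul, hφe, if_pos rfl, hψmul _ 1 (edg_mul_smul R α 0) (hpe α), ha]
      · rw [hL.edge_eq_zero α i (by rw [h1 α]; omega), zero_mul]
        exact zero_mem S
    · intro α i a (ha : _ = a)
      by_cases hi : i = 0
      · subst hi
        change ψ (φ _) = _
        rw [map_mul, hφg, if_pos rfl, hψmul _ (-1) (gst_mul_smul R α 0) (hpg α), ha]
      · rw [hL.ghost_eq_zero α i (by rw [h1 α]; omega), zero_mul]
        exact zero_mem S
  have hinj : ∀ a, φ a = 0 → a = 0 := fun a h => by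
    have : a ∈ S := hS ▸ Submodule.mem_top
    rw [← show ψ (φ a) = a from this, h, map_zero]
  refine ⟨⟨E.proj R (E.vtx R v), 0, fun h => ?_⟩, fun a b hab => ?_⟩
  · have := hφv v
    rw [h, map_zero, hT0] at this
    exact zero_ne_one this
  · have : φ a * φ b = 0 := by rw [← map_mul, hab, map_zero]
    exact (mul_eq_zero.1 this).imp (hinj a) (hinj b)

end Rose

end WeightedGraph

/-! ### Partitions of `ℕ` and a representation in which no generator vanishes. -/

section Injections

/-- A nonempty family of copies of `ℕ` fills `ℕ` up. -/
theorem exists_injections {T : Type*} [Countable T] (s : Set T) :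
    ∃ x : T → ℕ → ℕ, (∀ a, Function.Injective (x a)) ∧
      (∀ a ∈ s, ∀ b ∈ s, a ≠ b → ∀ m n, x a m ≠ x b n) ∧
      (s.Nonempty → ∀ m, ∃ a ∈ s, ∃ n, x a n = m) := by
  classical
  rcases s.eq_empty_or_nonempty with rfl | hs
  · exact ⟨fun _ => id, fun _ => Function.injective_id, by simp, by simp⟩
  have : Nonempty s := hs.to_subtype
  obtain ⟨ε⟩ : Nonempty (s × ℕ ≃ ℕ) := nonempty_equiv_of_countable
  -- Injectivity is demanded for all indices, so the identity is used outside `s`.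
  refine ⟨fun a n => if h : a ∈ s then ε (⟨a, h⟩, n) else n, fun a m n h => ?_,
    fun a ha b hb hab m n h => ?_, fun _ m => ?_⟩
  · by_cases ha : a ∈ s
    · simpa [ha] using h
    · simpa [ha] using h
  · simp only [dif_pos ha, dif_pos hb, EmbeddingLike.apply_eq_iff_eq, Prod.mk.injEq,
      Subtype.mk.injEq] at h
    exact hab h.1
  · refine ⟨(ε.symm m).1, (ε.symm m).1.2, (ε.symm m).2, ?_⟩
    simp

variable {R : Type w} [Ring R] {A B : Type*}

theorem lcomapDomain_lmapDomain {f : A → B} (hf : Function.Injective f) (m : A →₀ R) :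
    Finsupp.lcomapDomain (R := R) f hf (Finsupp.lmapDomain R R f m) = m :=
  Finsupp.comapDomain_mapDomain f hf m

theorem lcomapDomain_lmapDomain_of_ne {C : Type*} {f : A → B} {g : C → B}
    (hf : Function.Injective f) (h : ∀ a c, f a ≠ g c) (m : C →₀ R) :
    Finsupp.lcomapDomain (R := R) f hf (Finsupp.lmapDomain R R g m) = 0 := by
  ext a
  change Finsupp.mapDomain g m (f a) = 0
  refine Finsupp.mapDomain_of_notMem_range _ _ ?_
  rintro ⟨c, hc⟩
  exact h a c hc.symm

theorem lmapDomain_ne_zero {f : A → B} (hf : Function.Injective f) {m : A →₀ R} (hm : m ≠ 0) :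
    Finsupp.lmapDomain R R f m ≠ 0 := fun h =>
  hm (by rw [← lcomapDomain_lmapDomain hf m, h, map_zero])

theorem sum_lmapDomain_lcomapDomain {T : Type*} (s : Finset T) {f : T → A → B}
    (hf : ∀ a, Function.Injective (f a))
    (hdisj : ∀ a ∈ s, ∀ b ∈ s, a ≠ b → ∀ m n, f a m ≠ f b n) (hcov : ∀ m, ∃ a ∈ s, ∃ n, f a n = m)
    (m : B →₀ R) :
    ∑ a ∈ s, Finsupp.lmapDomain R R (f a) (Finsupp.lcomapDomain (R := R) (f a) (hf a) m) = m := by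
  have key : ∑ a ∈ s, (Finsupp.lmapDomain R R (f a)).comp
      (Finsupp.lcomapDomain (R := R) (f a) (hf a)) = LinearMap.id := by
    ext1 b
    ext1
    obtain ⟨a, ha, n, rfl⟩ := hcov b
    have hs : Finsupp.single (f a n) (1 : R) = Finsupp.lmapDomain R R (f a) (.single n 1) := by
      simp
    simp only [LinearMap.comp_apply, LinearMap.sum_apply, Finsupp.lsingle_apply, LinearMap.id_apply]
    rw [Finset.sum_eq_single_of_mem a ha, hs, lcomapDomain_lmapDomain]
    intro b hb hba
    rw [hs, lcomapDomain_lmapDomain_of_ne (hf b) (hdisj b hb a ha hba), map_zero]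
  have := LinearMap.congr_fun key m
  simpa [LinearMap.sum_apply] using this

end Injections

namespace WeightedGraph

variable {E : WeightedGraph.{u, v}} (R : Type w) [Ring R]

/-- Nonzero multiples of the generators of a weighted Leavitt path algebra are nonzero. -/
theorem smul_proj_gen_ne_zero (x : E.Gen) {r : R} (hr : r ≠ 0) :
    r • E.proj R (E.gen R x) ≠ 0 := by
  classical
  have := E.countable_stEdge
  -- `X v i` splits `ℕ` into copies of itself indexed by the structured edges leaving `v` of weight
  -- above `i`, and `Z α` does so for the indices below the weight of `α`, whenever these index sets
  -- are nonempty.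
  choose X hX hXd hXc using fun (v : E.Vertex) (i : ℕ) =>
    exists_injections {α | E.source α = v ∧ i < E.weight α}
  choose Z hZ hZd hZc using fun α : E.StEdge => exists_injections {i | i < E.weight α}
  have hI : ∀ v : E.Vertex, Function.Injective (Prod.mk v : ℕ → E.Vertex × ℕ) :=
    fun v => Prod.mk_right_injective v
  let I : E.Vertex → (ℕ →₀ R) →ₗ[R] (E.Vertex × ℕ →₀ R) := fun v =>
    Finsupp.lmapDomain R R (Prod.mk v)
  let I' : E.Vertex → (E.Vertex × ℕ →₀ R) →ₗ[R] (ℕ →₀ R) := fun v =>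
    Finsupp.lcomapDomain (R := R) (Prod.mk v) (hI v)
  let S : E.StEdge → ℕ → (ℕ →₀ R) →ₗ[R] (ℕ →₀ R) := fun α i =>
    Finsupp.lmapDomain R R (X (E.source α) i α)
  let S' : E.StEdge → ℕ → (ℕ →₀ R) →ₗ[R] (ℕ →₀ R) := fun α i =>
    Finsupp.lcomapDomain (R := R) (X (E.source α) i α) (hX _ _ _)
  let Q : E.StEdge → ℕ → (ℕ →₀ R) →ₗ[R] (ℕ →₀ R) := fun α i => Finsupp.lmapDomain R R (Z α i)
  let Q' : E.StEdge → ℕ → (ℕ →₀ R) →ₗ[R] (ℕ →₀ R) := fun α i =>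
    Finsupp.lcomapDomain (R := R) (Z α i) (hZ _ _)
  have hII : ∀ v m, I' v (I v m) = m := fun v m => lcomapDomain_lmapDomain _ m
  have hII' : ∀ v w m, v ≠ w → I' v (I w m) = 0 := fun v w m h =>
    lcomapDomain_lmapDomain_of_ne _ (fun _ _ h' => h (Prod.mk.inj h').1) m
  have hSS : ∀ α i m, S' α i (S α i m) = m := fun α i m => lcomapDomain_lmapDomain _ m
  have hQQ : ∀ α i m, Q' α i (Q α i m) = m := fun α i m => lcomapDomain_lmapDomain _ m
  -- The edge `α_i` carries part `i` of the copy at the range onto part `α` of the `i`-th partition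
  -- at the source, and `α_i*` goes back. Relation (3) sums over the parts at the source, relation
  -- (4) over those at the range.
  let V : E.Vertex → Module.End R (E.Vertex × ℕ →₀ R) := fun v => I v ∘ₗ I' v
  let e : E.StEdge → ℕ → Module.End R (E.Vertex × ℕ →₀ R) := fun α i =>
    if i < E.weight α then I (E.source α) ∘ₗ S α i ∘ₗ Q' α i ∘ₗ I' (E.range α) else 0
  let g : E.StEdge → ℕ → Module.End R (E.Vertex × ℕ →₀ R) := fun α i =>
    if i < E.weight α then I (E.range α) ∘ₗ Q α i ∘ₗ S' α i ∘ₗ I' (E.source α) else 0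
  have he : ∀ α i, i < E.weight α → ∀ m, e α i m = I (E.source α) (S α i (Q' α i (I' (E.range α) m))) :=
    fun α i hi m => by simp only [e, if_pos hi]; rfl
  have hg : ∀ α i, i < E.weight α → ∀ m, g α i m = I (E.range α) (Q α i (S' α i (I' (E.source α) m))) :=
    fun α i hi m => by simp only [g, if_pos hi]; rfl
  have hVV : ∀ v m, V v m = I v (I' v m) := fun v m => rfl
  have he0 : ∀ α i, E.weight α ≤ i → e α i = 0 := fun α i hi => if_neg (not_lt.2 hi)
  have hg0 : ∀ α i, E.weight α ≤ i → g α i = 0 := fun α i hi => if_neg (not_lt.2 hi)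
  have hfam : E.IsLeavittFamily V e g := by
    refine ⟨he0, hg0, fun v => LinearMap.ext fun m => ?_, fun v w hvw => LinearMap.ext fun m => ?_,
      fun α i hi => LinearMap.ext fun m => ?_, fun α i hi => LinearMap.ext fun m => ?_,
      fun α i hi => LinearMap.ext fun m => ?_, fun α i hi => LinearMap.ext fun m => ?_,
      fun v i hi => LinearMap.ext fun m => ?_, fun v i j hi hj hij => ?_,
      fun α => LinearMap.ext fun m => ?_, fun α β hαβ => ?_⟩
    · rw [Module.End.mul_apply, hVV, hVV, hII]
    · rw [Module.End.mul_apply, hVV, hVV, hII' v w _ hvw, map_zero]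
      rfl
    · rw [Module.End.mul_apply, he α i hi, hVV, hII]
    · rw [Module.End.mul_apply, he α i hi, he α i hi, hVV, hII]
    · rw [Module.End.mul_apply, hg α i hi, hVV, hII]
    · rw [Module.End.mul_apply, hg α i hi, hg α i hi, hVV, hII]
    · have hsum : ∑ α ∈ E.outEdges v with i < E.weight α,
          Finsupp.lmapDomain R R (X v i α) (Finsupp.lcomapDomain (R := R) (X v i α) (hX v i α)
            (I' v m)) = I' v m := by
        obtain ⟨α, hα, hiα⟩ := Finset.lt_sup_iff.1 hi
        refine sum_lmapDomain_lcomapDomain (R := R) _ (hX v i) (fun α hα β hβ => ?_) (fun n => ?_) _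
        · rw [Finset.mem_filter, mem_outEdges] at hα hβ
          exact hXd v i α hα β hβ
        · obtain ⟨β, hβ, h⟩ := hXc v i ⟨α, E.mem_outEdges.1 hα, hiα⟩ n
          exact ⟨β, Finset.mem_filter.2 ⟨E.mem_outEdges.2 hβ.1, hβ.2⟩, h⟩
      rw [hVV, ← hsum, map_sum, Finset.sum_filter, LinearMap.sum_apply]
      refine Finset.sum_congr rfl fun α hα => ?_
      obtain rfl := E.mem_outEdges.1 hα
      split_ifs with hiα
      · rw [Module.End.mul_apply, he α i hiα, hg α i hiα, hII, hQQ]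
      · rw [he0 α i (not_lt.1 hiα), zero_mul, LinearMap.zero_apply]
    · refine Finset.sum_eq_zero fun α _ => LinearMap.ext fun m => ?_
      by_cases hiα : i < E.weight α
      · by_cases hjα : j < E.weight α
        · rw [Module.End.mul_apply, he α i hiα, hg α j hjα, hII,
            lcomapDomain_lmapDomain_of_ne (hZ α i) (hZd α i hiα j hjα hij), map_zero, map_zero]
          rfl
        · rw [hg0 α j (not_lt.1 hjα), mul_zero]
      · rw [he0 α i (not_lt.1 hiα), zero_mul]
    · have hsum : ∑ i ∈ Finset.range (E.weight α),
          Q α i (Q' α i (I' (E.range α) m)) = I' (E.range α) m := by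
        refine sum_lmapDomain_lcomapDomain (R := R) _ (hZ α) (fun i hi j hj => ?_) (fun n => ?_) _
        · exact hZd α i (Finset.mem_range.1 hi) j (Finset.mem_range.1 hj)
        · obtain ⟨i, hi, h⟩ := hZc α ⟨0, E.weight_pos α⟩ n
          exact ⟨i, Finset.mem_range.2 hi, h⟩
      rw [hVV, ← hsum, map_sum, LinearMap.sum_apply]
      refine Finset.sum_congr rfl fun i hi => ?_
      rw [Finset.mem_range] at hi
      rw [Module.End.mul_apply, he α i hi, hg α i hi, hII, hSS]
    · refine Finset.sum_eq_zero fun i _ => LinearMap.ext fun m => ?_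
      by_cases hiα : i < E.weight α
      · by_cases hiβ : i < E.weight β
        · rw [Module.End.mul_apply, he β i hiβ, hg α i hiα]
          by_cases hs : E.source α = E.source β
          · rw [hs, hII]
            have : S' α i (S β i (Q' β i (I' (E.range β) m))) = 0 :=
              lcomapDomain_lmapDomain_of_ne _
                (fun a c => hs ▸ hXd (E.source α) i α ⟨rfl, hiα⟩ β ⟨hs.symm, hiβ⟩ hαβ a c) _
            rw [this, map_zero, map_zero]
            rfl
          · rw [hII' _ _ _ hs, map_zero, map_zero, map_zero]
            rfl
        · rw [he0 β i (not_lt.1 hiβ), mul_zero]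
      · rw [hg0 α i (not_lt.1 hiα), zero_mul]
  obtain ⟨φ, hφ, hφV, hφe, hφg⟩ := hfam.exists_action
  have hnz : (Finsupp.single 0 r : ℕ →₀ R) ≠ 0 := by simpa using hr
  intro h0
  have hact : ∀ m, r • φ (E.proj R (E.gen R x)) m = 0 := fun m => by
    rw [← hφ, h0, map_zero]
    rfl
  -- Each generator is tested on a basis vector that it does not kill.
  match x with
  | .vertex v =>
    have h1 : r • φ (E.proj R (E.vtx R v)) (I v (.single 0 1)) = 0 := hact _
    rw [hφV, hVV, hII, ← map_smul] at h1
    exact lmapDomain_ne_zero (hI v) (by simpa using hr) h1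
  | .edge α ⟨i, hi⟩ =>
    have h1 := hact (I (E.range α) (Q α i (.single 0 1)))
    rw [proj_gen_edge, hφe, he α i hi, hII, hQQ, ← map_smul, ← map_smul] at h1
    exact lmapDomain_ne_zero (hI _) (lmapDomain_ne_zero (hX _ _ _) (by simpa using hr)) h1
  | .ghost α ⟨i, hi⟩ =>
    have h1 := hact (I (E.source α) (S α i (.single 0 1)))
    rw [proj_gen_ghost, hφg, hg α i hi, hII, hSS, ← map_smul, ← map_smul] at h1
    exact lmapDomain_ne_zero (hI _) (lmapDomain_ne_zero (hZ _ _) (by simpa using hr)) h1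

/-! ### Necessity of the conditions on the ring and the graph. -/

section Necessity

variable {R}

theorem proj_vtx_ne_zero [Nontrivial R] (v : E.Vertex) : E.proj R (E.vtx R v) ≠ 0 := by
  have := E.smul_proj_gen_ne_zero R (.vertex v) (one_ne_zero (α := R))
  rwa [one_smul] at this

theorem proj_edg_ne_zero [Nontrivial R] {α : E.StEdge} {i : ℕ} (hi : i < E.weight α) :
    E.proj R (E.edg R α i) ≠ 0 := by
  have := E.smul_proj_gen_ne_zero R (.edge α ⟨i, hi⟩) (one_ne_zero (α := R))
  rwa [one_smul, proj_gen_edge] at this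

theorem proj_gst_ne_zero [Nontrivial R] {α : E.StEdge} {i : ℕ} (hi : i < E.weight α) :
    E.proj R (E.gst R α i) ≠ 0 := by
  have := E.smul_proj_gen_ne_zero R (.ghost α ⟨i, hi⟩) (one_ne_zero (α := R))
  rwa [one_smul, proj_gen_ghost] at this

theorem nonempty_vertex_of_nontrivial (h : Nontrivial (E.LeavittPathAlgebra R)) :
    Nonempty E.Vertex := by
  by_contra hE
  have hgen : E.Gen → False := by
    rintro (v | ⟨α, _⟩ | ⟨α, _⟩)
    exacts [hE ⟨v⟩, hE ⟨E.source α⟩, hE ⟨E.source α⟩]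
  have := E.submodule_eq_top R ⊥ (fun x => (hgen x).elim) fun x => (hgen x).elim
  exact bot_ne_top this

/-- Since `(a v)(b v) = (a b) v` and nonzero multiples of `v` are nonzero, zero divisors of `R`
would survive in the algebra. -/
theorem isDomain_of_isRingDomain (h : IsRingDomain (E.LeavittPathAlgebra R)) : IsDomain R := by
  have hnt := h.1
  obtain ⟨v⟩ := nonempty_vertex_of_nontrivial hnt
  have : Nontrivial R := Module.nontrivial R (E.LeavittPathAlgebra R)
  have : NoZeroDivisors R := by
    refine ⟨fun {a b} hab => ?_⟩
    by_contra! hne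
    have hx := h.2 (a • E.proj R (E.gen R (.vertex v))) (b • E.proj R (E.gen R (.vertex v))) (by
      rw [smul_mul_assoc, proj_gen_mul_smul, smul_smul, hab, zero_smul])
    exact hx.elim (E.smul_proj_gen_ne_zero R _ hne.1) (E.smul_proj_gen_ne_zero R _ hne.2)
  exact NoZeroDivisors.to_isDomain R

theorem isRose_of_isRingDomain (h : IsRingDomain (E.LeavittPathAlgebra R)) : E.IsRose := by
  have := isDomain_of_isRingDomain h
  refine Nat.card_eq_one_iff_unique.2 ⟨⟨fun v w => ?_⟩, nonempty_vertex_of_nontrivial h.1⟩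
  by_contra hvw
  exact (h.2 _ _ ((E.isLeavittFamily_proj R).vertex_mul_of_ne v w hvw)).elim
    (proj_vtx_ne_zero v) (proj_vtx_ne_zero w)

/-- If the weighted Leavitt path algebra is a domain, then an edge of weight one is the only
edge. -/
theorem eq_of_weight_eq_one (h : IsRingDomain (E.LeavittPathAlgebra R)) {α : E.StEdge}
    (hα : E.weight α = 1) (β : E.StEdge) : β = α := by
  have := isDomain_of_isRingDomain h
  have hL := E.isLeavittFamily_proj R
  by_contra hne
  have h1 := hL.ghost_mul_edge_of_ne α β fun h => hne h.symm
  -- As `α` has weight one, relation (4) shrinks to `α_1* β_1 = 0`.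
  rw [Finset.sum_eq_single_of_mem 0 (by simp [hα])] at h1
  · exact (h.2 _ _ h1).elim (proj_gst_ne_zero (E.weight_pos α)) (proj_edg_ne_zero (E.weight_pos β))
  · intro i _ hi
    rw [hL.ghost_eq_zero α i (by omega), zero_mul]

/-- If the weighted Leavitt path algebra is a domain, then maximal weights that are not one are
attained more than once. -/
theorem two_le_card_of_isRingDomain (h : IsRingDomain (E.LeavittPathAlgebra R))
    (h2 : ∀ α, 2 ≤ E.weight α) {v : E.Vertex} (hv : ¬ E.IsSink v) :
    2 ≤ ((E.outEdges v).filter fun α => E.weight α = E.maxWeight v).card := by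
  have := isDomain_of_isRingDomain h
  have hL := E.isLeavittFamily_proj R
  simp only [IsSink, not_forall, not_not] at hv
  obtain ⟨γ, hγ⟩ := hv
  obtain ⟨α, hα, hmax⟩ := (E.outEdges v).exists_mem_eq_sup ⟨γ, E.mem_outEdges.2 hγ⟩ E.weight
  change E.maxWeight v = _ at hmax
  by_contra! hlt
  have huniq : ∀ β ∈ E.outEdges v, β ≠ α → E.weight β < E.maxWeight v := by
    intro β hβ hne
    refine lt_of_le_of_ne (Finset.le_sup (f := E.weight) hβ) fun hβ' => hne ?_
    exact Finset.card_le_one.1 (Nat.le_of_lt_succ hlt) β (Finset.mem_filter.2 ⟨hβ, hβ'⟩) α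
      (Finset.mem_filter.2 ⟨hα, hmax.symm⟩)
  have hN := h2 α
  -- Counting from `0`, `E.maxWeight v - 1` is the top index, at which only `α` has an edge; it
  -- differs from `0` because weights are at least two. So relation (3) has a single term.
  have h1 := hL.edge_mul_ghost_of_ne v (E.maxWeight v - 1) 0 (by omega) (by omega) (by omega)
  rw [Finset.sum_eq_single_of_mem α hα] at h1
  · exact (h.2 _ _ h1).elim (proj_edg_ne_zero (by omega)) (proj_gst_ne_zero (by omega))
  · intro β hβ hne
    have := huniq β hβ hne
    rw [hL.edge_eq_zero β _ (by omega), zero_mul]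

end Necessity

theorem isRingDomain_iff :
    IsRingDomain (E.LeavittPathAlgebra R) ↔
      IsDomain R ∧ ((E.IsRose ∧ E.IsUnweighted ∧ Subsingleton E.StEdge) ∨ E.IsLVRose) := by
  constructor
  · intro h
    refine ⟨isDomain_of_isRingDomain h, ?_⟩
    have hrose := isRose_of_isRingDomain h
    obtain ⟨hs, hne⟩ := Nat.card_eq_one_iff_unique.1 hrose
    by_cases h1 : ∃ α, E.weight α = 1
    · obtain ⟨α, hα⟩ := h1
      have hall := eq_of_weight_eq_one h hα
      exact Or.inl ⟨hrose, fun β => by rw [hall β, hα], ⟨fun β γ => by rw [hall β, hall γ]⟩⟩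
    · rcases isEmpty_or_nonempty E.StEdge with he | he
      -- A rose without petals is vacuously unweighted.
      · exact Or.inl ⟨hrose, fun β => isEmptyElim β, inferInstance⟩
      · have h2 : ∀ α, 2 ≤ E.weight α := by
          intro α
          have := E.weight_pos α
          have : E.weight α ≠ 1 := fun h' => h1 ⟨α, h'⟩
          omega
        refine Or.inr ⟨⟨he, ⟨hne, fun v w => ?_⟩, h2, fun v hv =>
          two_le_card_of_isRingDomain h h2 hv⟩, hrose⟩
        rw [Subsingleton.elim v w]
        exact Relation.ReflTransGen.refl
  · rintro ⟨hR, ⟨hrose, h1, hsub⟩ | ⟨hLV, hrose⟩⟩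
    · obtain ⟨hs, ⟨v⟩⟩ := Nat.card_eq_one_iff_unique.1 hrose
      exact isRingDomain_of_subsingleton R v h1 hsub
    · obtain ⟨hs, ⟨v⟩⟩ := Nat.card_eq_one_iff_unique.1 hrose
      obtain ⟨γ⟩ := hLV.nonempty_stEdge
      obtain ⟨α₀, h0, α₁, h1, hne⟩ := Finset.one_lt_card.1
        (hLV.two_le_card v fun h => h γ (Subsingleton.elim _ _))
      exact isRingDomain_of_LVRose R v hLV.two_le_weight α₀ α₁ hne.symm (Finset.mem_filter.1 h0).2
        (Finset.mem_filter.1 h1).2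

end WeightedGraph

theorem mainTheorem4 (R : Type w) [Ring R] :
    (∀ E : WeightedGraph.{u, v},
      IsRingDomain (E.LeavittPathAlgebra R) ↔
        IsDomain R ∧ ((E.IsRose ∧ E.IsUnweighted ∧ Subsingleton E.StEdge) ∨ E.IsLVRose)) ∧
    (∀ n k : ℕ, IsDomain R → 2 ≤ n → IsDomain (LeavittAlgebra R n (n + k))) := by
  refine ⟨fun E => WeightedGraph.isRingDomain_iff R, fun n k hR hn => ?_⟩
  have h := LeavittAlgebra.isRingDomain R hn (show 2 ≤ n + k by omega)
  have := h.1
  have : NoZeroDivisors (LeavittAlgebra R n (n + k)) := ⟨fun {a b} => h.2 a b⟩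
  exact NoZeroDivisors.to_isDomain _
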